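/- **Setting.** Let $G$ be a finite graph (loops allowed), $V=V(G)$, and let $G^\circ$ be $G$ with all self-loops $vv$ added; put $E=E(G^\circ)$ and $\overline{X}=E\setminus X$. For $X\subseteq V$ and $e\in E$ the *edge component* $\gamma^X_e$ is $\{e\}$ if $e\subseteq X$, and otherwise the set of all edges with an end in the component of $G^\circ\setminus X$ containing an end of $e$. For $X\subseteq E$ let $\delta(X)$ be the set of vertices incident both to an edge in $X$ and to an edge in $\overline X$; for a partition $\pi$ of $E$ (empty cells allowed) $\delta(\pi)=\bigcup_{X\in\pi}\delta(X)$. **Pre-tree decompositions.** A *pre-tree decomposition* of $G^\circ$ is a rooted tree $(T,r)$ with bags $\beta(t)\subseteq V$ and cones $\gamma(s,t),\gamma(t,s)\subseteq E$ for each tree edge $st$ such that: $\beta(r)=\emptyset$ and for each component $C$ of $G^\circ$ some child $c$ of $r$ has $\gamma(r,c)=E(C)$; $|\gamma(p,\ell)|\le 1$ for each leaf $\ell\neq r$ with parent $p$; for every node $t$ the family $\pi_t$ of all $\gamma(t,u)$, $u$ a neighbour of $t$ (together with $\overline{\gamma(t,p)}$ if $t\ne r$ is a leaf with parent $p$), is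 a partition of $E$ with $\delta(\pi_t)\subseteq\beta(t)$; and $\gamma(s,t)\cap\gamma(t,s)=\emptyset$ for each tree edge. It is *exact* if $\gamma(s,t)\cup\gamma(t,s)=E$ for every tree edge and $\beta(t)=\delta(\pi_t)$ for every node. Its *depth* is $\max_t\sum_{s\in P_t\setminus\{r\}}|\beta(s)\setminus\beta(p_s)|$, where $P_t$ is the path from $r$ to $t$ and $p_s$ is the parent of $s$. Leaves are the nodes without children; $L(T)$ is the set of leaves. **Game and strategy tree.** Let $k,q\ge1$. In the $q$-placement $k$-cops-and-robber game on $G^\circ$ the cops start on $X_0=\emptyset$ and the robber on an edge $e_0\in E$ of his choice. In round $i$ the cops move from $X_{i-1}$ to a subset of it or to $X_{i-1}\cup\{v\}$ (a placement), always with $|X_i|\le k$, and the robber moves from $e_{i-1}$ to an edge $e_i\in\gamma^{X_{i-1}\cap X_i}_{e_{i-1}}$. The cops win in round $i$ if $e_i\subseteq X_i$; the robber wins if the cops have not yet won when $q$ placements have been made, or if he is never caught. Let $\sigma$ be a winning cop strategy that depends only on the cop position $X$ and the edge component of the robber, written $\sigma(X,\gamma^X_e)$. Its *strategy tree* $(T,r,\beta,\gamma)$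 has $\beta(r)=\emptyset$ and one child $c$ of $r$ with $\gamma(r,c)=E(C)$ for each component $C$ of $G^\circ$. For a node $t\neq r$ with parent $s$: if $\gamma(s,t)=\{e\}$ with $e\subseteq\beta(s)$ (the robber is caught), then $\beta(t)=e$ and $t$ is a leaf; otherwise $\beta(t)=\sigma(\beta(s),\gamma(s,t))$ and $t$ has one child $c$ with $\gamma(t,c)=R$ for each edge component $R$ with respect to $\beta(t)$ that meets $\gamma(s,t)$. Finally $\gamma(t,s)=\overline{\bigcup_c\gamma(t,c)}$ (union over the children $c$ of $t$) if $t$ is not a leaf, and $\gamma(t,s)=\overline{\gamma(s,t)}$ if $t$ is a leaf. A node $t\ne r$ with parent $s$ is *branching* if some vertex of $\beta(t)\setminus\beta(s)$ is incident to an edge of $\gamma(s,t)$, i.e. a cop is newly placed into the robber's escape space. **Construction.** Let $s_1,\dots,s_n$ be the nodes of $T$ ordered level by level from the root (e.g. in breadth-first order), let $(\beta_0,\gamma_0)=(\beta,\gamma)$, and let $T_i$ be the subtree on $s_1,\dots,s_i$ and their neighbours. In step $i$, nothing changes if $s_i$ is a leaf. Otherwise let $t_1,\dots,t_a$ be the children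 of $s_i$. Choose pairwise disjoint $F_j\subseteq\overline{\gamma_{i-1}(t_j,s_i)}\cap\overline{\gamma_{i-1}(s_i,t_j)}$ such that, with $F=\bigcup_jF_j$, the partition obtained from $\pi_{s_i}$ by replacing each $\gamma_{i-1}(s_i,t_j)$ by $(\gamma_{i-1}(s_i,t_j)\setminus F)\cup F_j$ and the cone to the parent (if any) by itself minus $F$ has a boundary $\delta$ of minimum size and, subject to this, $|F|$ is minimum (remaining ties are broken arbitrarily). Put $F^*_j=\big((\overline{\gamma_{i-1}(t_j,s_i)}\cap\overline{\gamma_{i-1}(s_i,t_j)})\cup F\big)\setminus F_j$. For $p\in V(T_i)$ with child $c$ set $$\gamma_i(p,c)=\begin{cases}(\gamma_{i-1}(p,c)\setminus F)\cup F_j&(p,c)=(s_i,t_j)\\ \gamma_{i-1}(p,c)\setminus F^*_j&p=t_j\\ \gamma_{i-1}(p,c)\cup F&c\text{ on the path from }r\text{ to }s_i\\ \gamma_{i-1}(p,c)\setminus F&\text{otherwise,}\end{cases}$$ and, for $c\in V(T_i)\setminus\{r\}$ with parent $p$, $$\gamma_i(c,p)=\begin{cases}\gamma_{i-1}(c,p)\cup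 F^*_j&(p,c)=(s_i,t_j)\\ \gamma_{i-1}(c,p)&p=t_j\\ \gamma_{i-1}(c,p)\setminus F&c\text{ on the path from }r\text{ to }s_i\\ \gamma_{i-1}(c,p)\cup F&\text{otherwise.}\end{cases}$$ All other cones stay unchanged; $\beta_i(t)=\delta(\pi^i_t)$ for $t\in V(T_i)$, where $\pi^i_t$ is formed with the cones $\gamma_i$, and $\beta_i(t)=\beta_{i-1}(t)$ otherwise. **Statement.** For every winning strategy $\sigma$ as above the strategy tree is finite and the construction can be carried out. For every order $s_1,\dots,s_n$ as above and all choices made in the construction, $(T,r,\beta_n,\gamma_n)$ is an exact pre-tree decomposition of $G^\circ$, and $$\operatorname{dep}(T,r,\beta_n,\gamma_n)\;\le\;\max_{\ell\in L(T)}\bigl|\{t\in P_\ell : t\text{ is a branching node of the strategy tree}\}\bigr| .$$ So cop placements outside the robber's escape space do not count towards the depth. -/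

import Mathlib

open Set

/-! A graph on the vertex set `V`, loops allowed, is given by its set `E : Set (Sym2 V)` of edges. -/

/-- `G°`: the graph with all self-loops added. -/
def withLoops {V : Type*} (G : Set (Sym2 V)) : Set (Sym2 V) :=
  G ∪ {e | ∃ v, e = s(v, v)}

/-- The graph `G \ X` (deleted vertices stay in the type as isolated vertices). -/
def deleteVerts {V : Type*} (E : Set (Sym2 V)) (X : Set V) : SimpleGraph V where
  Adj u v := u ≠ v ∧ s(u, v) ∈ E ∧ u ∉ X ∧ v ∉ X
  symm := ⟨fun u v h => ⟨h.1.symm, Sym2.eq_swap (a := u) (b := v) ▸ h.2.1, h.2.2.2, h.2.2.1⟩⟩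
  loopless := ⟨fun _ h => h.1 rfl⟩

/-- The set of edges of the component of the edge component graph `G^X` that contains the edge
`e`: just `e` if both ends of `e` are in `X`, and otherwise all edges with an end in the component
of `G \ X` that contains an end of `e`. -/
def edgeComp {V : Type*} (E : Set (Sym2 V)) (X : Set V) (e : Sym2 V) : Set (Sym2 V) :=
  {f | f ∈ E ∧ (f = e ∨
    ∃ u ∈ e, ∃ v ∈ f, u ∉ X ∧ v ∉ X ∧ (deleteVerts E X).Reachable u v)}

/-- The edge sets of the components of `G^X`. -/
def edgeComps {V : Type*} (E : Set (Sym2 V)) (X : Set V) : Set (Set (Sym2 V)) :=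
  {R | ∃ e ∈ E, R = edgeComp E X e}

/-! ### Rooted trees and pre-tree decompositions -/

/-- A rooted tree with node set `N`, given by the parent function. The value `parent root = root`
is a convention only. -/
structure RTree (N : Type*) where
  root : N
  parent : N → N
  parent_root : parent root = root
  reach : ∀ t, ∃ m, parent^[m] t = root

namespace RTree

variable {N : Type*} (T : RTree N)

/-- `c` is a child of `p`. -/
def IsChild (p c : N) : Prop := c ≠ T.root ∧ T.parent c = p

def IsLeaf (t : N) : Prop := ∀ c, ¬ T.IsChild t c

/-- `s ⪯ t`: the node `s` lies on the path `P_t` from the root to `t`. -/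
def Below (s t : N) : Prop := ∃ m, T.parent^[m] t = s

open Classical in
/-- The distance from the root. -/
noncomputable def level (t : N) : ℕ := Nat.find (T.reach t)

end RTree

/-- The set `δ(X)` of the vertices that are incident both to `X` and to `E \ X`. -/
def bdry {V : Type*} (E X : Set (Sym2 V)) : Set V :=
  {v | ∃ e ∈ X, ∃ f ∈ E \ X, v ∈ e ∧ v ∈ f}

/-- The boundary `δ(π)` of a family of edge sets. -/
def famBdry {V ι : Type*} (E : Set (Sym2 V)) (P : ι → Set (Sym2 V)) : Set V :=
  {v | ∃ i, v ∈ bdry E (P i)}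

/-- `P` is a partition of `E`; empty cells are allowed. -/
def IsPartitionOf {V ι : Type*} (E : Set (Sym2 V)) (P : ι → Set (Sym2 V)) : Prop :=
  (⋃ i, P i) = E ∧ Pairwise fun i j => Disjoint (P i) (P j)

/-- The data `(β, γ)` on a rooted tree. The directed tree edges are the pairs `(p, t)` and `(t, p)`
for a node `t` other than the root with parent `p`; we write `down t` for `γ(p, t)` and `up t` for
`γ(t, p)`. The values of `down` and `up` at the root have no meaning. -/
@[ext] structure TreeData (N V : Type*) where
  bag : N → Set V
  down : N → Set (Sym2 V)
  up : N → Set (Sym2 V)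

/-- The family `π_t`: the cones at the edges from `t` to its children and to its parent, and, if `t`
is a leaf, the complement of the cone to the parent. All other cells are empty. -/
def cells {N V : Type*} (T : RTree N) (E : Set (Sym2 V)) (down up : N → Set (Sym2 V)) (t : N) :
    N ⊕ Bool → Set (Sym2 V)
  | .inl c => {e | T.IsChild t c ∧ e ∈ down c}
  | .inr false => {e | t ≠ T.root ∧ e ∈ up t}
  | .inr true => {e | t ≠ T.root ∧ T.IsLeaf t ∧ e ∈ E \ up t}

namespace TreeData

variable {N V : Type*} (T : RTree N) (E : Set (Sym2 V)) (D : TreeData N V)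

/-- Rooted pre-tree decompositions of the graph with edge set `E`. -/
structure IsPreTree : Prop where
  bag_root : D.bag T.root = ∅
  comp : ∀ C : (deleteVerts E ∅).ConnectedComponent,
    ∃ c, T.IsChild T.root c ∧ D.down c = {e | e ∈ E ∧ ∃ u ∈ e, u ∈ C.supp}
  leaf : ∀ t, t ≠ T.root → T.IsLeaf t → (D.down t).encard ≤ 1
  part : ∀ t, IsPartitionOf E (cells T E D.down D.up t)
  bdry_subset : ∀ t, famBdry E (cells T E D.down D.up t) ⊆ D.bag t
  disj : ∀ t, t ≠ T.root → Disjoint (D.down t) (D.up t)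

structure IsExact : Prop where
  edge : ∀ t, t ≠ T.root → D.down t ∪ D.up t = E
  bag_eq : ∀ t, D.bag t = famBdry E (cells T E D.down D.up t)

/-- The sum of `|β(s) \ β(p_s)|` over the nodes `s` other than the root on the path from the root
to `t`; these nodes are `t`, its parent, and so on, `T.level t` many. -/
noncomputable def depthAt (t : N) : ℕ∞ :=
  ∑ m ∈ Finset.range (T.level t),
    (D.bag (T.parent^[m] t) \ D.bag (T.parent^[m + 1] t)).encard

/-- The depth of a rooted pre-tree decomposition. -/
noncomputable def depth : ℕ∞ := ⨆ t, D.depthAt T t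

/-- `t` is a branching node: moving from the bag of the parent to that of `t`, a new cop is placed
on a vertex incident to the robber escape space `γ(p, t)`. -/
def IsBranching (t : N) : Prop :=
  t ≠ T.root ∧ ∃ v, v ∈ D.bag t ∧ v ∉ D.bag (T.parent t) ∧ ∃ e ∈ D.down t, v ∈ e

end TreeData

/-! ### The game -/

/-- A (positional) strategy of `k` cops: legal moves that depend only on the cop position and on
the edge component in which the robber is. -/
structure CopStrategy {V : Type*} (E : Set (Sym2 V)) (k : ℕ) where
  move : Set V → Sym2 V → Set V
  card_le : ∀ X e, X.encard ≤ (k : ℕ∞) → e ∈ E → (move X e).encard ≤ (k : ℕ∞)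
  legal : ∀ X e, X.encard ≤ (k : ℕ∞) → e ∈ E → move X e ⊆ X ∨ ∃ v, move X e = insert v X
  const : ∀ X e f, X.encard ≤ (k : ℕ∞) → e ∈ E → f ∈ edgeComp E X e → move X f = move X e

/-- The counter after round `i`: the number of rounds up to `i` in which a cop was placed. -/
noncomputable def placements {V : Type*} (X : ℕ → Set V) (i : ℕ) : ℕ :=
  {a | a < i ∧ ¬ X (a + 1) ⊆ X a}.ncard

namespace CopStrategy

variable {V : Type*} {E : Set (Sym2 V)} {k : ℕ} (σ : CopStrategy E k)

/-- A play in which the cops follow `σ`, with the cops on `X i` and the robber on `e i` after round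
`i`. In round `i + 1` the robber runs along a path whose inner vertices avoid `X i ∩ X (i + 1)`.
Plays are continued after a capture; this is of no consequence. -/
structure IsPlay (X : ℕ → Set V) (e : ℕ → Sym2 V) : Prop where
  cops_zero : X 0 = ∅
  robber_zero : e 0 ∈ E
  cops_succ : ∀ i, X (i + 1) = σ.move (X i) (e i)
  robber_succ : ∀ i, e (i + 1) ∈ edgeComp E (X i ∩ X (i + 1)) (e i)

/-- `σ` wins the `q`-placement game: in every play the robber is captured in some round, and the
counter had not reached `q` in any earlier round. -/
def IsWinning (q : ℕ) : Prop :=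
  ∀ X e, σ.IsPlay X e →
    ∃ i, (∀ v ∈ e i, v ∈ X i) ∧ ∀ m < i, placements X m < q

/-! ### The strategy tree -/

/-- `σ(X, R)` for an edge component `R`: the common value of `σ.move X e` for `e ∈ R`. -/
def moveOn (X : Set V) (R : Set (Sym2 V)) : Set V := {v | ∃ e ∈ R, v ∈ σ.move X e}

/-- The robber is caught: his edge component is a single edge with both ends occupied. -/
def Caught (X : Set V) (R : Set (Sym2 V)) : Prop := ∃ e, R = {e} ∧ ∀ v ∈ e, v ∈ X

open Classical in
/-- The bag of a node of the strategy tree. A node is the list of the cones on its path from the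
root, the last one first. -/
noncomputable def pos : List (Set (Sym2 V)) → Set V
  | [] => ∅
  | R :: l => if Caught (pos l) R then {v | ∃ e ∈ R, v ∈ e} else σ.moveOn (pos l) R

inductive IsNode : List (Set (Sym2 V)) → Prop
  | root : IsNode []
  | first (R) : R ∈ edgeComps E ∅ → IsNode [R]
  | step (R' R l) : IsNode (R :: l) → ¬ Caught (σ.pos l) R →
      R' ∈ edgeComps E (σ.pos (R :: l)) → (R' ∩ R).Nonempty → IsNode (R' :: R :: l)

theorem IsNode.tail {σ : CopStrategy E k} {l : List (Set (Sym2 V))} (h : σ.IsNode l) : σ.IsNode l.tail := by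
  cases h with
  | root => exact .root
  | first R _ => exact .root
  | step R' R l h _ _ _ => exact h

/-- The nodes of the strategy tree. -/
abbrev Node : Type _ := {l : List (Set (Sym2 V)) // σ.IsNode l}

/-- The strategy tree as a rooted tree. -/
def tree : RTree σ.Node where
  root := ⟨[], .root⟩
  parent t := ⟨t.1.tail, t.2.tail⟩
  parent_root := rfl
  reach t := by
    have key : ∀ (n : ℕ) (t : σ.Node), t.1.length = n →
        (fun t : σ.Node => (⟨t.1.tail, t.2.tail⟩ : σ.Node))^[n] t = ⟨[], .root⟩ := by
      intro n
      induction n with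
      | zero => intro t h; exact Subtype.ext (List.length_eq_zero_iff.mp h)
      | succ n ih => intro t h; exact ih ⟨t.1.tail, t.2.tail⟩ (by simp [h])
    exact ⟨_, key _ t rfl⟩

/-- The cone `γ(p, t)` of the strategy tree. -/
def coneDown (t : σ.Node) : Set (Sym2 V) := t.1.headD ∅

/-- The strategy tree with its bags and cones. -/
noncomputable def treeData : TreeData σ.Node V where
  bag t := σ.pos t.1
  down := σ.coneDown
  up t := {e | e ∈ E ∧ (∀ c, σ.tree.IsChild t c → e ∉ σ.coneDown c) ∧
    (σ.tree.IsLeaf t → e ∉ σ.coneDown t)}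

end CopStrategy

/-! ### Making a tree exact -/

section Construction

variable {N V : Type*} (T : RTree N) (E : Set (Sym2 V))

/-- The choices of the sets `F_c`, for the children `c` of `x`, that are allowed at `x`. -/
structure Admissible (D : TreeData N V) (x : N) (F : N → Set (Sym2 V)) : Prop where
  child : ∀ c, T.IsChild x c → F c ⊆ (E \ D.up c) ∩ (E \ D.down c)
  other : ∀ c, ¬ T.IsChild x c → F c = ∅
  disj : Pairwise fun c d => Disjoint (F c) (F d)

/-- The partition that results from `π_x` by the `F_c`-extensions in the cones `γ(x, c)`. -/
def extCells (D : TreeData N V) (x : N) (F : N → Set (Sym2 V)) (j : N ⊕ Bool) : Set (Sym2 V) :=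
  (cells T E D.down D.up x j \ ⋃ c, F c) ∪ Sum.elim F (fun _ => ∅) j

/-- An admissible choice whose partition has minimum boundary and which, among these, has the
smallest union. -/
structure Optimal (D : TreeData N V) (x : N) (F : N → Set (Sym2 V)) : Prop where
  adm : Admissible T E D x F
  min_bdry : ∀ F', Admissible T E D x F' →
    (famBdry E (extCells T E D x F)).encard ≤ (famBdry E (extCells T E D x F')).encard
  min_union : ∀ F', Admissible T E D x F' →
    (famBdry E (extCells T E D x F')).encard = (famBdry E (extCells T E D x F)).encard →
    (⋃ c, F c).encard ≤ (⋃ c, F' c).encard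

/-- The set `F*_c`. -/
def fStar (D : TreeData N V) (F : N → Set (Sym2 V)) (c : N) : Set (Sym2 V) :=
  (((E \ D.up c) ∩ (E \ D.down c)) ∪ ⋃ d, F d) \ F c

open Classical in
/-- The new cones `γ(p, c)`, where `p` is the parent of `c`, after considering the node `x`; `S` is
the node set of the current subtree `T_i`. -/
noncomputable def newDown (D : TreeData N V) (S : Set N) (x : N) (F : N → Set (Sym2 V)) (c : N) :
    Set (Sym2 V) :=
  if c = T.root ∨ T.parent c ∉ S then D.down c
  else if T.parent c = x then (D.down c \ ⋃ d, F d) ∪ F c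
  else if T.IsChild x (T.parent c) then D.down c \ fStar E D F (T.parent c)
  else if T.Below c x then D.down c ∪ ⋃ d, F d
  else D.down c \ ⋃ d, F d

open Classical in
/-- The new cones `γ(c, p)`, where `p` is the parent of `c`. They change only on the edges of the
current subtree. -/
noncomputable def newUp (D : TreeData N V) (S : Set N) (x : N) (F : N → Set (Sym2 V)) (c : N) :
    Set (Sym2 V) :=
  if c = T.root ∨ c ∉ S then D.up c
  else if T.parent c = x then D.up c ∪ fStar E D F c
  else if T.IsChild x (T.parent c) then D.up c
  else if T.Below c x then D.up c \ ⋃ d, F d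
  else D.up c ∪ ⋃ d, F d

open Classical in
noncomputable def newData (D : TreeData N V) (S : Set N) (x : N) (F : N → Set (Sym2 V)) :
    TreeData N V where
  bag t := if t ∈ S then
      famBdry E (cells T E (newDown T E D S x F) (newUp T E D S x F) t)
    else D.bag t
  down := newDown T E D S x F
  up := newUp T E D S x F

/-- The node set of `T_i`: the nodes considered so far and their neighbours. -/
def subtreeNodes {n : ℕ} (s : Fin n ≃ N) (i : Fin n) : Set N :=
  {t | ∃ a, a ≤ i ∧ (t = s a ∨ T.IsChild (s a) t ∨ T.IsChild t (s a))}

/-- One step of the construction, in which the node `s i` is considered. -/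
def IsStep {n : ℕ} (s : Fin n ≃ N) (i : Fin n) (D D' : TreeData N V) : Prop :=
  (T.IsLeaf (s i) ∧ D' = D) ∨
  (¬ T.IsLeaf (s i) ∧ ∃ F, Optimal T E D (s i) F ∧
    D' = newData T E D (subtreeNodes T s i) (s i) F)

/-- `D 0, …, D n` is a run of the construction that starts with `D₀` and considers the nodes in the
breadth-first order `s 0, …, s (n - 1)`, that is, level by level. -/
structure IsRun (D₀ : TreeData N V) {n : ℕ} (s : Fin n ≃ N) (D : ℕ → TreeData N V) : Prop where
  bfs : ∀ a b, a ≤ b → T.level (s a) ≤ T.level (s b)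
  start : D 0 = D₀
  step : ∀ i : Fin n, IsStep T E s i (D i) (D (i + 1))

end Construction

/-! The depth bound is carried through the construction by an invariant, `RunInv`: for the set `Q`
of nodes considered so far, the tree edges below nodes of `Q` are exact, the cones further out are
still those of the strategy tree, and for each node whose parent is in `Q` the depth is at most the
number of branching nodes of the strategy tree on its path. Let `x` be the next node. Three effects
have to be controlled.

On the path to `x`, single terms of the depth may grow. Since the root bag is empty, however, the
depth at `t` equals the size of the bag of `t` plus the number of vertices dropped along the path
(`depthAt_add_encard_bag_root`). No bag on the path grows: by submodularity of boundaries
(`encard_famBdry_uncross`), a larger bag at `t` would yield a choice at `x` with smaller boundary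
than the optimal one. No set of dropped vertices grows either, because the cones towards `x` only
gain edges.

At the other nodes already in the subtree, the moved edges go to the cone towards the parent. The
vertices that are new at such a node are the boundary vertices not touching that cone, so no vertex
becomes new.

At a child `t` of `x`, a vertex that is new after the step touches two child cones of `t` but not
the cone to `x`. These cones come from the strategy tree, and there the loops of `G°` force the
vertex to be newly placed in the escape space (`treeData_steady`). So `t` is branching, and it
contributes at most one, as a move places at most one cop.

Finiteness of the tree is Kőnig's lemma: an infinite branch would be a play in which the robber is
never caught. -/

namespace RTree

/-! ### Rooted trees given by a parent function. -/

variable {N : Type*} (T : RTree N)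

theorem induction {P : N → Prop} (h0 : P T.root)
    (h1 : ∀ t, t ≠ T.root → P (T.parent t) → P t) (t : N) : P t := by
  obtain ⟨m, hm⟩ := T.reach t
  induction m generalizing t with
  | zero => exact (show t = T.root from hm) ▸ h0
  | succ m ih =>
    by_cases ht : t = T.root
    · exact ht ▸ h0
    · exact h1 t ht (ih _ (by simpa [Function.iterate_succ_apply] using hm))

theorem level_root : T.level T.root = 0 := by
  classical
  unfold level
  rw [Nat.find_eq_zero]
  rfl

variable {T}

theorem level_of_ne {t : N} (h : t ≠ T.root) : T.level t = T.level (T.parent t) + 1 := by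
  classical
  unfold level
  rw [Nat.find_eq_iff]
  refine ⟨Nat.find_spec (T.reach (T.parent t)), ?_⟩
  intro n hn
  cases n with
  | zero => exact h
  | succ n => exact Nat.find_min (T.reach (T.parent t)) (Nat.lt_of_succ_lt_succ hn)

theorem IsChild.level {x c : N} (h : T.IsChild x c) : T.level c = T.level x + 1 := by
  rw [level_of_ne h.1, h.2]

theorem level_parent_le (t : N) : T.level (T.parent t) ≤ T.level t := by
  by_cases h : t = T.root
  · rw [h, T.parent_root]
  · rw [level_of_ne h]; omega

theorem Below.refl (t : N) : T.Below t t := ⟨0, rfl⟩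

theorem Below.trans {r s t : N} (h : T.Below r s) (h' : T.Below s t) : T.Below r t := by
  obtain ⟨m, rfl⟩ := h
  obtain ⟨n, rfl⟩ := h'
  exact ⟨m + n, Function.iterate_add_apply _ _ _ _⟩

theorem parent_below (t : N) : T.Below (T.parent t) t := ⟨1, rfl⟩

theorem root_below (t : N) : T.Below T.root t := T.reach t

theorem below_root {s : N} (h : T.Below s T.root) : s = T.root := by
  obtain ⟨m, rfl⟩ := h
  exact Function.iterate_fixed T.parent_root m

theorem below_iff {s t : N} : T.Below s t ↔ s = t ∨ T.Below s (T.parent t) := by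
  constructor
  · rintro ⟨m, hm⟩
    cases m with
    | zero => exact .inl hm.symm
    | succ m => exact .inr ⟨m, hm⟩
  · rintro (rfl | h)
    · exact .refl _
    · exact h.trans (parent_below t)

theorem Below.level_le {s t : N} (h : T.Below s t) : T.level s ≤ T.level t := by
  obtain ⟨m, rfl⟩ := h
  induction m with
  | zero => exact le_rfl
  | succ m ih => rw [Function.iterate_succ_apply']; exact (level_parent_le _).trans ih

theorem Below.eq_of_level {s t : N} (h : T.Below s t) (hl : T.level s = T.level t) : s = t := by
  by_cases ht : t = T.root
  · subst ht; exact below_root h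
  · rcases below_iff.1 h with h | h
    · exact h
    · have := h.level_le
      rw [level_of_ne ht] at hl
      omega

theorem Below.total {r s t : N} (h : T.Below r t) (h' : T.Below s t) :
    T.Below r s ∨ T.Below s r := by
  obtain ⟨m, rfl⟩ := h
  obtain ⟨n, rfl⟩ := h'
  rcases le_total m n with h | h
  · exact .inr ⟨n - m, by rw [← Function.iterate_add_apply, Nat.sub_add_cancel h]⟩
  · exact .inl ⟨m - n, by rw [← Function.iterate_add_apply, Nat.sub_add_cancel h]⟩

theorem IsChild.eq_of_below {t c d x : N} (hc : T.IsChild t c) (hd : T.IsChild t d)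
    (hcx : T.Below c x) (hdx : T.Below d x) : c = d := by
  have hl : T.level c = T.level d := by rw [hc.level, hd.level]
  rcases hcx.total hdx with h | h
  · exact h.eq_of_level hl
  · exact (h.eq_of_level hl.symm).symm

theorem IsChild.not_below {x c : N} (h : T.IsChild x c) : ¬ T.Below c x := fun hb => by
  have := hb.level_le
  rw [h.level] at this
  omega

theorem IsChild.ne {x c : N} (h : T.IsChild x c) : c ≠ x := fun he =>
  h.not_below (he ▸ .refl _)

theorem exists_child_below {x y : N} (h : T.Below y x) (hne : y ≠ x) :
    ∃ c, T.IsChild y c ∧ T.Below c x := by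
  induction x using T.induction with
  | h0 => exact absurd (below_root h) hne
  | h1 x hx ih =>
    have h := (below_iff.1 h).resolve_left hne
    by_cases hy : y = T.parent x
    · exact ⟨x, ⟨hx, hy.symm⟩, .refl _⟩
    · obtain ⟨c, hc, hcx⟩ := ih h hy
      exact ⟨c, hc, hcx.trans (parent_below x)⟩

theorem exists_leaf_above [Finite N] (t : N) : ∃ ℓ, T.IsLeaf ℓ ∧ T.Below t ℓ := by
  obtain ⟨ℓ, hℓ, hmax⟩ := Set.exists_max_image {s | T.Below t s} T.level (Set.toFinite _)
    ⟨t, .refl t⟩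
  refine ⟨ℓ, fun c hc => ?_, hℓ⟩
  have := hmax c (Below.trans hℓ (hc.2 ▸ parent_below c))
  rw [hc.level] at this
  omega

end RTree

/-! ### Partitions and their boundaries -/

section Partition

variable {V ι κ : Type*} {E : Set (Sym2 V)}

/-- The vertex `v` is incident to an edge in `A`. -/
def Inc (A : Set (Sym2 V)) (v : V) : Prop := ∃ e ∈ A, v ∈ e

theorem Inc.mono {A B : Set (Sym2 V)} (h : A ⊆ B) {v : V} : Inc A v → Inc B v :=
  fun ⟨e, he, hv⟩ => ⟨e, h he, hv⟩

theorem IsPartitionOf.subset {P : ι → Set (Sym2 V)} (hP : IsPartitionOf E P) (i : ι) :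
    P i ⊆ E := hP.1 ▸ subset_iUnion P i

theorem IsPartitionOf.exists_mem {P : ι → Set (Sym2 V)} (hP : IsPartitionOf E P) {e : Sym2 V}
    (he : e ∈ E) : ∃ i, e ∈ P i := by
  rw [← hP.1] at he
  exact mem_iUnion.1 he

theorem IsPartitionOf.eq_of_mem {P : ι → Set (Sym2 V)} (hP : IsPartitionOf E P) {e : Sym2 V}
    {i j : ι} (hi : e ∈ P i) (hj : e ∈ P j) : i = j := by
  by_contra h
  exact disjoint_left.1 (hP.2 h) hi hj

theorem mem_famBdry_of_inc {P : ι → Set (Sym2 V)} (hP : IsPartitionOf E P) {v : V} {i j : ι}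
    (hij : i ≠ j) (hi : Inc (P i) v) (hj : Inc (P j) v) : v ∈ famBdry E P := by
  obtain ⟨e, he, hev⟩ := hi
  obtain ⟨f, hf, hfv⟩ := hj
  exact ⟨i, e, he, f, ⟨hP.subset j hf, fun h => hij (hP.eq_of_mem h hf)⟩, hev, hfv⟩

theorem exists_inc_of_mem_famBdry {P : ι → Set (Sym2 V)} (hP : IsPartitionOf E P) {v : V}
    (h : v ∈ famBdry E P) : ∃ i j, i ≠ j ∧ Inc (P i) v ∧ Inc (P j) v := by
  obtain ⟨i, e, he, f, hf, hev, hfv⟩ := h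
  obtain ⟨j, hj⟩ := hP.exists_mem hf.1
  exact ⟨i, j, fun hij => hf.2 (hij ▸ hj), ⟨e, he, hev⟩, f, hj, hfv⟩

/-- A boundary vertex is incident to two cells, of which the first is not the `b`-th cell. -/
theorem exists_inc_ne_of_mem_famBdry {P : ι → Set (Sym2 V)} (hP : IsPartitionOf E P) {v : V}
    (h : v ∈ famBdry E P) (b : ι) :
    ∃ i j, i ≠ b ∧ i ≠ j ∧ Inc (P i) v ∧ Inc (P j) v := by
  obtain ⟨i, j, hij, hi, hj⟩ := exists_inc_of_mem_famBdry hP h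
  by_cases hb : i = b
  · exact ⟨j, i, fun h => hij (hb.trans h.symm), hij.symm, hj, hi⟩
  · exact ⟨i, j, hb, hij, hi, hj⟩

/-- The edges in the sets `H j` are moved to the cells `P j`. -/
def redistribute (P H : ι → Set (Sym2 V)) (j : ι) : Set (Sym2 V) := (P j \ ⋃ i, H i) ∪ H j

/-- The edges in `G` are moved to the cell with index `a`. -/
def shiftTo (P : ι → Set (Sym2 V)) (a : ι) (G : Set (Sym2 V)) (j : ι) : Set (Sym2 V) :=
  (P j \ G) ∪ {e | j = a ∧ e ∈ G}

theorem IsPartitionOf.redistribute {P H : ι → Set (Sym2 V)} (hP : IsPartitionOf E P)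
    (hH : Pairwise fun i j => Disjoint (H i) (H j)) (hE : ∀ i, H i ⊆ E) :
    IsPartitionOf E (redistribute P H) := by
  constructor
  · ext e
    simp only [_root_.redistribute, mem_iUnion, mem_union, mem_sdiff, not_exists]
    constructor
    · rintro ⟨i, h | h⟩
      · exact hP.subset i h.1
      · exact hE i h
    · intro he
      by_cases h : ∃ i, e ∈ H i
      · exact h.imp fun i hi => .inr hi
      · obtain ⟨i, hi⟩ := hP.exists_mem he
        exact ⟨i, .inl ⟨hi, fun j hj => h ⟨j, hj⟩⟩⟩
  · intro i j hij
    rw [disjoint_left]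
    rintro e (hi | hi) (hj | hj)
    · exact disjoint_left.1 (hP.2 hij) hi.1 hj.1
    · exact hi.2 (mem_iUnion.2 ⟨j, hj⟩)
    · exact hj.2 (mem_iUnion.2 ⟨i, hi⟩)
    · exact disjoint_left.1 (hH hij) hi hj

theorem shiftTo_eq_redistribute (P : ι → Set (Sym2 V)) (a : ι) (G : Set (Sym2 V)) :
    shiftTo P a G = redistribute P fun j => {e | j = a ∧ e ∈ G} := by
  have : ⋃ j, {e | j = a ∧ e ∈ G} = G := by ext e; simp
  funext j
  rw [shiftTo, redistribute, this]

theorem IsPartitionOf.shiftTo {P : ι → Set (Sym2 V)} (hP : IsPartitionOf E P) (a : ι)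
    {G : Set (Sym2 V)} (hG : G ⊆ E) : IsPartitionOf E (shiftTo P a G) := by
  rw [shiftTo_eq_redistribute]
  refine hP.redistribute (fun i j hij => ?_) fun i e he => hG he.2
  refine disjoint_left.2 ?_
  exact fun e hi hj => hij (hi.1.trans hj.1.symm)

/-- A vertex that avoids the enlarged cell touches no moved edge, so the cells around it are the
same before and after the shift. -/
theorem mem_of_mem_famBdry_shiftTo {P : ι → Set (Sym2 V)} (hP : IsPartitionOf E P) {a : ι}
    {G : Set (Sym2 V)} (hG : G ⊆ E) {v : V} (hv : v ∈ famBdry E (shiftTo P a G))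
    (hav : ¬ Inc (shiftTo P a G a) v) : v ∈ famBdry E P ∧ ¬ Inc (P a) v := by
  constructor
  · obtain ⟨i, j, hij, hi, hj⟩ := exists_inc_of_mem_famBdry (hP.shiftTo a hG) hv
    have key : ∀ i, Inc (shiftTo P a G i) v → Inc (P i) v := by
      rintro i ⟨e, he | he, hev⟩
      · exact ⟨e, he.1, hev⟩
      · exact absurd ⟨e, .inr ⟨rfl, he.2⟩, hev⟩ hav
    exact mem_famBdry_of_inc hP hij (key i hi) (key j hj)
  · rintro ⟨e, he, hev⟩
    refine hav ⟨e, ?_, hev⟩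
    by_cases h : e ∈ G
    · exact .inr ⟨rfl, h⟩
    · exact .inl ⟨he, h⟩

/-- Submodularity of the boundary for two crossing partitions. -/
theorem encard_famBdry_uncross {P H : ι → Set (Sym2 V)} {R : κ → Set (Sym2 V)}
    (hP : IsPartitionOf E P) (hR : IsPartitionOf E R) {b : ι} {a : κ}
    (hPR : ∀ i, i ≠ b → P i ⊆ R a) (hb : H b = ∅)
    (hH : Pairwise fun i j => Disjoint (H i) (H j)) (hE : ∀ i, H i ⊆ E) :
    (famBdry E (redistribute P fun i => H i ∩ R a)).encard +
        (famBdry E (shiftTo R a (⋃ i, H i))).encard ≤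
      (famBdry E (redistribute P H)).encard + (famBdry E R).encard := by
  have hG : ⋃ i, H i ⊆ E := iUnion_subset hE
  have hP1 := hP.redistribute hH hE
  have hP2 : IsPartitionOf E (redistribute P fun i => H i ∩ R a) :=
    hP.redistribute (fun i j hij => (hH hij).mono inter_subset_left inter_subset_left)
      fun i => inter_subset_left.trans (hE i)
  have hR1 := hR.shiftTo a hG
  -- The two new partitions behave like intersection and union in ordinary submodularity: apart from
  -- cell `b`, the cells of the first lie in `R a`; apart from cell `a`, those of the second lie in
  -- cell `b` of `redistribute P H`.
  have f1 : ∀ i, i ≠ b → (redistribute P fun i => H i ∩ R a) i ⊆ redistribute P H i ∩ R a := by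
    rintro i hi e (⟨he, he'⟩ | he)
    · refine ⟨.inl ⟨he, fun h => he' ?_⟩, hPR i hi he⟩
      obtain ⟨j, hj⟩ := mem_iUnion.1 h
      exact mem_iUnion.2 ⟨j, hj, hPR i hi he⟩
    · exact ⟨.inr he.1, he.2⟩
  have f2 : ∀ j, j ≠ a → shiftTo R a (⋃ i, H i) j ⊆ redistribute P H b ∩ R j := by
    rintro j hj e (⟨he, he'⟩ | he)
    · refine ⟨.inl ⟨?_, he'⟩, he⟩
      obtain ⟨i, hi⟩ := hP.exists_mem (hR.subset j he)
      by_cases hib : i = b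
      · exact hib ▸ hi
      · exact absurd (hR.eq_of_mem he (hPR i hib hi)) hj
    · exact absurd he.1 hj
  have hHb : ∀ {e}, e ∈ (⋃ i, H i) → ∃ i, i ≠ b ∧ e ∈ redistribute P H i := by
    intro e he
    obtain ⟨i, hi⟩ := mem_iUnion.1 he
    refine ⟨i, ?_, .inr hi⟩
    rintro rfl
    simp [hb] at hi
  have f3 : ∀ e ∈ (redistribute P fun i => H i ∩ R a) b,
      e ∈ redistribute P H b ∨ ∃ j, j ≠ a ∧ e ∈ R j := by
    rintro e (⟨he, he'⟩ | he)
    · by_cases h : e ∈ ⋃ i, H i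
      · obtain ⟨j, hj⟩ := hR.exists_mem (hP.subset b he)
        refine .inr ⟨j, ?_, hj⟩
        rintro rfl
        obtain ⟨i, hi⟩ := mem_iUnion.1 h
        exact he' (mem_iUnion.2 ⟨i, hi, hj⟩)
      · exact .inl (.inl ⟨he, h⟩)
    · simp [hb] at he
  -- It suffices to compare unions with unions and intersections with intersections of the
  -- boundaries.
  rw [← encard_union_add_encard_inter, ← encard_union_add_encard_inter (famBdry E _)]
  refine add_le_add (encard_le_encard ?_) (encard_le_encard ?_)
  · rintro v (hv | hv)
    · obtain ⟨i, j, hib, hij, hi, hj⟩ := exists_inc_ne_of_mem_famBdry hP2 hv b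
      by_cases hjb : j = b
      · subst hjb
        obtain ⟨e, he, hev⟩ := hj
        rcases f3 e he with h | ⟨j', hj', h⟩
        · exact .inl (mem_famBdry_of_inc hP1 hij (hi.mono fun _ h => (f1 i hib h).1)
            ⟨e, h, hev⟩)
        · exact .inr (mem_famBdry_of_inc hR hj'.symm (hi.mono fun _ h => (f1 i hib h).2)
            ⟨e, h, hev⟩)
      · exact .inl (mem_famBdry_of_inc hP1 hij (hi.mono fun _ h => (f1 i hib h).1)
          (hj.mono fun _ h => (f1 j hjb h).1))
    · obtain ⟨i, j, hia, hij, hi, hj⟩ := exists_inc_ne_of_mem_famBdry hR1 hv a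
      by_cases hja : j = a
      · subst hja
        obtain ⟨e, he | he, hev⟩ := hj
        · exact .inr (mem_famBdry_of_inc hR hij (hi.mono fun _ h => (f2 i hia h).2)
            ⟨e, he.1, hev⟩)
        · obtain ⟨i', hi', h⟩ := hHb he.2
          exact .inl (mem_famBdry_of_inc hP1 hi' ⟨e, h, hev⟩
            (hi.mono fun _ h => (f2 i hia h).1))
      · exact .inr (mem_famBdry_of_inc hR hij (hi.mono fun _ h => (f2 i hia h).2)
          (hj.mono fun _ h => (f2 j hja h).2))
  -- A vertex in both new boundaries touches a cell other than `b` inside `R a`, and a cell other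
  -- than `a` inside cell `b`; this witnesses both old boundaries.
  · rintro v ⟨hv, hv'⟩
    obtain ⟨i, -, hib, -, hi, -⟩ := exists_inc_ne_of_mem_famBdry hP2 hv b
    obtain ⟨j, -, hja, -, hj, -⟩ := exists_inc_ne_of_mem_famBdry hR1 hv' a
    exact ⟨mem_famBdry_of_inc hP1 hib (hi.mono fun _ h => (f1 i hib h).1)
        (hj.mono fun _ h => (f2 j hja h).1),
      mem_famBdry_of_inc hR hja.symm (hi.mono fun _ h => (f1 i hib h).2)
        (hj.mono fun _ h => (f2 j hja h).2)⟩

end Partition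

/-! ### Cones of exact tree edges -/

section Cells

variable {N V : Type*} {T : RTree N} {E : Set (Sym2 V)} {down up : N → Set (Sym2 V)} {t : N}

theorem cells_inl (h : t ≠ T.root) : cells T E down up (T.parent t) (.inl t) = down t := by
  ext e
  exact ⟨fun he => he.2, fun he => ⟨⟨h, rfl⟩, he⟩⟩

theorem cells_up (h : t ≠ T.root) : cells T E down up t (.inr false) = up t := by
  ext e
  exact ⟨fun he => he.2, fun he => ⟨h, he⟩⟩

variable (hp : IsPartitionOf E (cells T E down up (T.parent t)))
  (ht : IsPartitionOf E (cells T E down up t)) (h : t ≠ T.root)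
  (hd : Disjoint (down t) (up t)) (hu : down t ∪ up t = E)

include hp h hu in
-- A boundary vertex meets a second cell besides any prescribed one. At the parent, every cell other
-- than `down t` lies in `up t` because the edge is exact.
theorem inc_up_of_mem_famBdry_parent {v : V}
    (hv : v ∈ famBdry E (cells T E down up (T.parent t))) : Inc (up t) v := by
  obtain ⟨i, -, hi, -, hiv, -⟩ := exists_inc_ne_of_mem_famBdry hp hv (.inl t)
  refine hiv.mono fun e he => ?_
  have he' := hp.subset i he
  rw [← hu] at he'
  refine he'.resolve_left fun hed => hi (hp.eq_of_mem he ?_)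
  rwa [cells_inl h]

include ht h hu in
theorem inc_down_of_mem_famBdry {v : V} (hv : v ∈ famBdry E (cells T E down up t)) :
    Inc (down t) v := by
  obtain ⟨i, -, hi, -, hiv, -⟩ := exists_inc_ne_of_mem_famBdry ht hv (.inr false)
  refine hiv.mono fun e he => ?_
  have he' := ht.subset i he
  rw [← hu] at he'
  refine he'.resolve_right fun heu => hi (ht.eq_of_mem he ?_)
  rwa [cells_up h]

include ht h hd hu in
theorem mem_famBdry_of_inc_down_up {v : V} (hv : Inc (down t) v) (hv' : Inc (up t) v) :
    v ∈ famBdry E (cells T E down up t) := by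
  obtain ⟨e, he, hev⟩ := hv
  obtain ⟨i, hi⟩ := ht.exists_mem (hu.subset (Or.inl he))
  refine mem_famBdry_of_inc ht (i := i) (j := .inr false) ?_ ⟨e, hi, hev⟩
    (by rwa [cells_up h])
  rintro rfl
  rw [cells_up h] at hi
  exact disjoint_left.1 hd he hi

include hp h hd hu in
theorem mem_famBdry_parent_of_inc_down_up {v : V} (hv : Inc (down t) v) (hv' : Inc (up t) v) :
    v ∈ famBdry E (cells T E down up (T.parent t)) := by
  obtain ⟨e, he, hev⟩ := hv'
  obtain ⟨i, hi⟩ := hp.exists_mem (hu.subset (Or.inr he))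
  refine mem_famBdry_of_inc hp (i := i) (j := .inl t) ?_ ⟨e, hi, hev⟩
    (by rwa [cells_inl h])
  rintro rfl
  rw [cells_inl h] at hi
  exact disjoint_left.1 hd hi he

include hp ht h hd hu in
-- Expresses the vertices dropped from the parent to `t` through a single cone, so that a step which
-- only enlarges this cone can be seen to drop no further vertex. `famBdry_diff_parent` is the dual
-- for the new vertices.
theorem famBdry_parent_diff : famBdry E (cells T E down up (T.parent t)) \
    famBdry E (cells T E down up t) =
      {v | v ∈ famBdry E (cells T E down up (T.parent t)) ∧ ¬ Inc (down t) v} := by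
  ext v
  refine and_congr_right fun hv => not_congr ⟨inc_down_of_mem_famBdry ht h hu, fun h' => ?_⟩
  exact mem_famBdry_of_inc_down_up ht h hd hu h' (inc_up_of_mem_famBdry_parent hp h hu hv)

include hp ht h hd hu in
theorem famBdry_diff_parent : famBdry E (cells T E down up t) \
    famBdry E (cells T E down up (T.parent t)) =
      {v | v ∈ famBdry E (cells T E down up t) ∧ ¬ Inc (up t) v} := by
  ext v
  refine and_congr_right fun hv =>
    not_congr ⟨inc_up_of_mem_famBdry_parent hp h hu, fun h' => ?_⟩
  exact mem_famBdry_parent_of_inc_down_up hp h hd hu (inc_down_of_mem_famBdry ht h hu hv) h'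

end Cells

/-! ### Depth -/

namespace TreeData

variable {N V : Type*} {T : RTree N} (D : TreeData N V)

theorem depthAt_root : D.depthAt T T.root = 0 := by
  simp [depthAt, T.level_root]

theorem depthAt_of_ne {t : N} (h : t ≠ T.root) :
    D.depthAt T t = D.depthAt T (T.parent t) + (D.bag t \ D.bag (T.parent t)).encard := by
  rw [depthAt, RTree.level_of_ne h, Finset.sum_range_succ']
  rfl

variable (T) in
/-- The sum of `|β(p_s) \ β(s)|` over the nodes `s` other than the root on the path to `t`. -/
noncomputable def codepthAt (t : N) : ℕ∞ :=
  ∑ m ∈ Finset.range (T.level t),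
    (D.bag (T.parent^[m + 1] t) \ D.bag (T.parent^[m] t)).encard

theorem codepthAt_root : D.codepthAt T T.root = 0 := by
  simp [codepthAt, T.level_root]

theorem codepthAt_of_ne {t : N} (h : t ≠ T.root) :
    D.codepthAt T t = D.codepthAt T (T.parent t) + (D.bag (T.parent t) \ D.bag t).encard := by
  rw [codepthAt, RTree.level_of_ne h, Finset.sum_range_succ']
  rfl

/-- Telescoping of `|A \ B| + |B| = |A ∪ B| = |B \ A| + |A|` along the path. The additive form
avoids subtraction in `ℕ∞`. -/
theorem depthAt_add_encard_bag_root (t : N) :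
    D.depthAt T t + (D.bag T.root).encard = (D.bag t).encard + D.codepthAt T t := by
  induction t using T.induction with
  | h0 => rw [depthAt_root, codepthAt_root, zero_add, add_zero]
  | h1 t ht ih =>
    rw [D.depthAt_of_ne ht, D.codepthAt_of_ne ht, add_right_comm, ih, add_right_comm,
      add_comm (D.bag (T.parent t)).encard, encard_sdiff_add_encard, union_comm,
      ← encard_sdiff_add_encard (D.bag (T.parent t)), add_right_comm, add_comm]
    ac_rfl

end TreeData

/-! ### One step of the construction -/

section Step

variable {N V : Type*} {T : RTree N} {E : Set (Sym2 V)} {D : TreeData N V} {Q : Set N} {x : N}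
  {F : N → Set (Sym2 V)}

/-- `x` is the next node to be considered when `Q` is the set of the nodes considered so far. -/
structure Frontier (T : RTree N) (Q : Set N) (x : N) : Prop where
  notMem : x ∉ Q
  closed : ∀ t ∈ Q, T.parent t ∈ Q
  parent_mem : x = T.root ∨ T.parent x ∈ Q

/-- The node set of the subtree spanned by the nodes in `Q` and their neighbours. -/
def hull (T : RTree N) (Q : Set N) : Set N := {t | T.parent t ∈ Q}

namespace Frontier

variable (fr : Frontier T Q x)
include fr

theorem parent_mem_of_mem {t : N} (ht : t ∈ insert x Q) : t = T.root ∨ T.parent t ∈ Q := by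
  rcases ht with rfl | ht
  · exact fr.parent_mem
  · exact .inr (fr.closed t ht)

theorem mem_insert_of_below {s t : N} (hst : T.Below s t) (ht : t ∈ insert x Q) :
    s ∈ insert x Q := by
  obtain ⟨m, rfl⟩ := hst
  induction m with
  | zero => exact ht
  | succ m ih =>
    rw [Function.iterate_succ_apply']
    rcases fr.parent_mem_of_mem ih with h | h
    · rw [h, T.parent_root, ← h]; exact ih
    · exact .inr h

theorem parent_mem_of_below {t : N} (h : T.Below t x) (ht : t ≠ T.root) : T.parent t ∈ Q :=
  (fr.parent_mem_of_mem (fr.mem_insert_of_below h (.inl rfl))).resolve_left ht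

theorem not_isChild_of_mem {t : N} (ht : t ∈ Q) : ¬ T.IsChild x t := fun h =>
  fr.notMem (h.2 ▸ fr.closed t ht)

omit fr in
-- The cases in which the cells change in different ways: outside the current subtree, `x` itself, a
-- child of `x`, a proper ancestor of `x`, and the remaining nodes of the subtree.
theorem trichotomy (t : N) : T.parent t ∉ insert x Q ∨ t = x ∨ T.IsChild x t ∨
    (T.Below t x ∧ t ≠ x) ∨ (T.parent t ∈ Q ∧ ¬ T.Below t x) := by
  by_cases h : T.parent t ∈ insert x Q
  · rcases h with h | h
    · by_cases ht : t = T.root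
      · rw [ht, T.parent_root] at h
        exact .inr (.inl (ht.trans h))
      · exact .inr (.inr (.inl ⟨ht, h⟩))
    · by_cases hb : T.Below t x
      · by_cases hx : t = x
        · exact .inr (.inl hx)
        · exact .inr (.inr (.inr (.inl ⟨hb, hx⟩)))
      · exact .inr (.inr (.inr (.inr ⟨h, hb⟩)))
  · exact .inl h

omit fr in
theorem newUp_child {c : N} (hc : T.IsChild x c) :
    newUp T E D (hull T (insert x Q)) x F c = D.up c ∪ fStar E D F c := by
  have hS : c ∈ hull T (insert x Q) := .inl hc.2
  simp [newUp, hc.1, hS, hc.2]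

theorem newUp_below {c : N} (h : c ≠ T.root) (hc : T.Below c x) :
    newUp T E D (hull T (insert x Q)) x F c = D.up c \ ⋃ d, F d := by
  have hp := fr.parent_mem_of_below hc h
  have hS : c ∈ hull T (insert x Q) := .inr hp
  have hx : T.parent c ≠ x := fun he => fr.notMem (he ▸ hp)
  simp [newUp, h, hS, hx, fr.not_isChild_of_mem hp, hc]

theorem newUp_other {c : N} (h : c ≠ T.root) (hp : T.parent c ∈ Q) (hc : ¬ T.Below c x) :
    newUp T E D (hull T (insert x Q)) x F c = D.up c ∪ ⋃ d, F d := by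
  have hS : c ∈ hull T (insert x Q) := .inr hp
  have hx : T.parent c ≠ x := fun he => fr.notMem (he ▸ hp)
  simp [newUp, h, hS, hx, fr.not_isChild_of_mem hp, hc]

omit fr in
theorem newUp_out {c : N} (hp : T.parent c ∉ insert x Q) :
    newUp T E D (hull T (insert x Q)) x F c = D.up c := if_pos (.inr hp)

theorem newDown_child {c : N} (hc : T.IsChild x c) :
    newDown T E D (hull T (insert x Q)) x F c = (D.down c \ ⋃ d, F d) ∪ F c := by
  have hS : x ∈ hull T (insert x Q) := by
    rcases fr.parent_mem with h | h
    · exact .inl (by rw [h, T.parent_root])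
    · exact .inr h
  simp [newDown, hc.1, hS, hc.2]

omit fr in
theorem newDown_grandchild {c : N} (h : c ≠ T.root) (hc : T.IsChild x (T.parent c)) :
    newDown T E D (hull T (insert x Q)) x F c = D.down c \ fStar E D F (T.parent c) := by
  have hS : T.parent c ∈ hull T (insert x Q) := .inl hc.2
  have hx : T.parent c ≠ x := hc.ne
  simp [newDown, h, hS, hx, hc]

theorem newDown_below {c : N} (h : c ≠ T.root) (hc : T.Below c x) :
    newDown T E D (hull T (insert x Q)) x F c = D.down c ∪ ⋃ d, F d := by
  have hp := fr.parent_mem_of_below hc h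
  have hS : T.parent c ∈ hull T (insert x Q) := .inr (fr.closed _ hp)
  have hx : T.parent c ≠ x := fun he => fr.notMem (he ▸ hp)
  simp [newDown, h, hS, hx, fr.not_isChild_of_mem hp, hc]

omit fr in
theorem newDown_other {c : N} (h : c ≠ T.root) (hp : T.parent (T.parent c) ∈ insert x Q)
    (hx : T.parent c ≠ x) (hcx : ¬ T.IsChild x (T.parent c)) (hc : ¬ T.Below c x) :
    newDown T E D (hull T (insert x Q)) x F c = D.down c \ ⋃ d, F d := by
  have hS : T.parent c ∈ hull T (insert x Q) := hp
  simp [newDown, h, hS, hx, hcx, hc]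

omit fr in
theorem newDown_out {c : N} (hp : T.parent (T.parent c) ∉ insert x Q) :
    newDown T E D (hull T (insert x Q)) x F c = D.down c := if_pos (.inr hp)

theorem newDown_subset {c : N} (h : c ≠ T.root) (hp : T.parent c ∉ insert x Q) :
    newDown T E D (hull T (insert x Q)) x F c ⊆ D.down c := by
  by_cases hS : T.parent (T.parent c) ∈ insert x Q
  · by_cases hcx : T.IsChild x (T.parent c)
    · rw [newDown_grandchild h hcx]; exact sdiff_subset
    · rw [newDown_other h hS (fun he => hp (.inl he)) hcx
        fun hb => hp (.inr (fr.parent_mem_of_below hb h))]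
      exact sdiff_subset
  · rw [newDown_out hS]

/-- This and the next lemmas describe a step node by node. At `x` the cells are extended by the
choice; at any other node of the subtree one set of edges is moved to one cell: `fStar` towards `x`
at a child of `x`, the union of the `F d` towards `x` at an ancestor, and towards the parent
elsewhere. -/
theorem cells_self (hx : ¬ T.IsLeaf x) (hF : ∀ c, ¬ T.IsChild x c → F c = ∅) :
    cells T E (newDown T E D (hull T (insert x Q)) x F) (newUp T E D (hull T (insert x Q)) x F) x =
      extCells T E D x F := by
  funext j
  rcases j with c | _ | _
  · by_cases hc : T.IsChild x c
    · ext e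
      simp [cells, extCells, hc, fr.newDown_child hc]
    · simp [cells, extCells, hc, hF c hc]
  · by_cases h : x = T.root
    · simp [cells, extCells, h]
    · ext e
      simp [cells, extCells, h, fr.newUp_below h (.refl x)]
  · simp [cells, extCells, hx]

omit fr in
theorem cells_child {t : N} (ht : T.IsChild x t) :
    cells T E (newDown T E D (hull T (insert x Q)) x F) (newUp T E D (hull T (insert x Q)) x F) t =
      shiftTo (cells T E D.down D.up t) (.inr false) (fStar E D F t) := by
  funext j
  rcases j with c | _ | _
  · by_cases hc : T.IsChild t c
    · have := newDown_grandchild (Q := Q) (E := E) (D := D) (F := F) hc.1 (hc.2.symm ▸ ht)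
      rw [hc.2] at this
      ext e
      simp [cells, shiftTo, hc, this]
    · simp [cells, shiftTo, hc]
  · ext e
    simp [cells, shiftTo, ht.1, newUp_child ht]
  · ext e
    simp only [cells, shiftTo, newUp_child ht]
    simp
    tauto

theorem cells_below {t c : N} (hc : T.IsChild t c) (hcx : T.Below c x) :
    cells T E (newDown T E D (hull T (insert x Q)) x F) (newUp T E D (hull T (insert x Q)) x F) t =
      shiftTo (cells T E D.down D.up t) (.inl c) (⋃ d, F d) := by
  have htx : T.Below t x := (hc.2 ▸ RTree.parent_below c : T.Below t c).trans hcx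
  have htne : t ≠ x := by rintro rfl; exact hc.not_below hcx
  have htnc : ¬ T.IsChild x t := fun h => h.not_below htx
  have htl : ¬ T.IsLeaf t := fun h => h c hc
  funext j
  rcases j with d | _ | _
  · by_cases hd : T.IsChild t d
    · by_cases hdc : d = c
      · subst hdc
        ext e
        simp [cells, shiftTo, hd, fr.newDown_below hd.1 hcx]
        rw [← not_exists]
        tauto
      · have hdx : ¬ T.Below d x := fun h => hdc (hd.eq_of_below hc h hcx)
        have hpp : T.parent (T.parent d) ∈ insert x Q := by
          rw [hd.2]
          exact fr.mem_insert_of_below ((RTree.parent_below t).trans htx) (.inl rfl)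
        ext e
        simp [cells, shiftTo, hd, hdc, newDown_other (E := E) (D := D) (F := F) hd.1 hpp
          (hd.2.symm ▸ htne) (hd.2.symm ▸ htnc) hdx]
    · have : d ≠ c := by rintro rfl; exact hd hc
      ext e
      simp [cells, shiftTo, hd, this]
  · by_cases h : t = T.root
    · simp [cells, shiftTo, h]
    · ext e
      simp [cells, shiftTo, h, fr.newUp_below h htx]
  · ext e
    simp [cells, shiftTo, htl]

theorem cells_other {t : N} (hp : T.parent t ∈ Q) (ht : ¬ T.Below t x) :
    cells T E (newDown T E D (hull T (insert x Q)) x F) (newUp T E D (hull T (insert x Q)) x F) t =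
      shiftTo (cells T E D.down D.up t) (.inr false) (⋃ d, F d) := by
  have htne : t ≠ x := by rintro rfl; exact ht (.refl t)
  have htr : t ≠ T.root := by rintro rfl; exact ht (RTree.root_below x)
  have htnc : ¬ T.IsChild x t := fun h => fr.notMem (h.2 ▸ hp)
  funext j
  rcases j with d | _ | _
  · by_cases hd : T.IsChild t d
    · have hdx : ¬ T.Below d x := fun h => ht ((hd.2 ▸ RTree.parent_below d : T.Below t d).trans h)
      have hpp : T.parent (T.parent d) ∈ insert x Q := by
        rw [hd.2]; exact .inr hp
      ext e
      simp [cells, shiftTo, hd, newDown_other (E := E) (D := D) (F := F) hd.1 hpp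
        (hd.2.symm ▸ htne) (hd.2.symm ▸ htnc) hdx]
    · ext e
      simp [cells, shiftTo, hd]
  · ext e
    simp [cells, shiftTo, htr, fr.newUp_other htr hp ht]
    rw [← not_exists]
    tauto
  · ext e
    simp only [cells, shiftTo, fr.newUp_other htr hp ht]
    simp
    tauto

omit fr in
theorem cells_out {t : N} (hp : T.parent t ∉ insert x Q) :
    cells T E (newDown T E D (hull T (insert x Q)) x F) (newUp T E D (hull T (insert x Q)) x F) t =
      cells T E D.down D.up t := by
  funext j
  rcases j with d | _ | _
  · by_cases hd : T.IsChild t d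
    · have hpp : T.parent (T.parent d) ∉ insert x Q := by rwa [hd.2]
      ext e
      simp [cells, hd, newDown_out (E := E) (D := D) (F := F) hpp]
    · ext e
      simp [cells, hd]
  · simp only [cells, newUp_out hp]
  · simp only [cells, newUp_out hp]

end Frontier

theorem extCells_eq_redistribute : extCells T E D x F =
    redistribute (cells T E D.down D.up x) (Sum.elim F fun _ => ∅) := by
  have : (⋃ j, (Sum.elim F (fun _ => ∅) : N ⊕ Bool → Set (Sym2 V)) j) = ⋃ c, F c := by
    ext e; simp
  funext j
  rw [extCells, redistribute, this]

namespace Admissible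

variable (hF : Admissible T E D x F)
include hF

theorem subset (c : N) : F c ⊆ E := by
  by_cases hc : T.IsChild x c
  · exact fun e he => (hF.child c hc he).1.1
  · simp [hF.other c hc]

theorem iUnion_subset : ⋃ c, F c ⊆ E := Set.iUnion_subset hF.subset

theorem fStar_subset (c : N) : fStar E D F c ⊆ E := by
  rintro e ⟨he | he, -⟩
  · exact he.1.1
  · exact hF.iUnion_subset he

theorem sumElim_subset (j : N ⊕ Bool) :
    (Sum.elim F (fun _ => ∅) : N ⊕ Bool → Set (Sym2 V)) j ⊆ E := by
  rcases j with c | _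
  · exact hF.subset c
  · exact empty_subset _

theorem sumElim_disjoint : Pairwise fun i j =>
    Disjoint ((Sum.elim F (fun _ => ∅) : N ⊕ Bool → Set (Sym2 V)) i)
      ((Sum.elim F (fun _ => ∅) : N ⊕ Bool → Set (Sym2 V)) j) := by
  rintro (c | _) (d | _) h
  · exact hF.disj fun hcd => h (congrArg _ hcd)
  all_goals simp

/-- Supplies the competitors for optimality: `A` will be a cone towards `x`, or empty, which means
changing nothing. -/
theorem inter (A : Set (Sym2 V)) : Admissible T E D x fun c => F c ∩ A where
  child c hc := inter_subset_left.trans (hF.child c hc)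
  other c hc := by simp [hF.other c hc]
  disj c d h := (hF.disj h).mono inter_subset_left inter_subset_left

end Admissible

end Step

/-! ### The invariant of the construction and the depth bound. -/

section Invariant

variable {N V : Type*}

/-- The number of branching nodes on the path from the root to `t`. -/
noncomputable def branchCount (T : RTree N) (D : TreeData N V) (t : N) : ℕ∞ :=
  {u | T.Below u t ∧ D.IsBranching T u}.encard

theorem branchCount_mono {T : RTree N} {D : TreeData N V} {s t : N} (h : T.Below s t) :
    branchCount T D s ≤ branchCount T D t :=
  encard_le_encard fun _ hu => ⟨hu.1.trans h, hu.2⟩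

/-- What the construction uses about the tree `D₀` with which it starts: a vertex that is separated
by the children of `t` and not incident to the cone from `t` to its parent is a new vertex of the
escape space, and there is at most one new vertex. -/
structure Steady (T : RTree N) (D₀ : TreeData N V) : Prop where
  separated : ∀ {t c d v}, t ≠ T.root → T.IsChild t c → T.IsChild t d → c ≠ d →
    Inc (D₀.down c) v → Inc (D₀.down d) v → ¬ Inc (D₀.up t) v →
    v ∈ D₀.bag t ∧ v ∉ D₀.bag (T.parent t) ∧ Inc (D₀.down t) v
  new_le_one : ∀ t, t ≠ T.root → (D₀.bag t \ D₀.bag (T.parent t)).encard ≤ 1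

/-- The state of the construction after the nodes in `Q` have been considered. -/
structure RunInv (T : RTree N) (E : Set (Sym2 V)) (D₀ : TreeData N V) (Q : Set N)
    (D : TreeData N V) : Prop where
  part : ∀ t, IsPartitionOf E (cells T E D.down D.up t)
  disj : ∀ t, t ≠ T.root → Disjoint (D.down t) (D.up t)
  edge : ∀ t, t ≠ T.root → T.parent t ∈ Q → D.down t ∪ D.up t = E
  up_eq : ∀ t, T.parent t ∉ Q → D.up t = D₀.up t
  down_eq : ∀ t, T.parent (T.parent t) ∉ Q → D.down t = D₀.down t
  bag_eq : ∀ t, T.parent t ∈ Q → D.bag t = famBdry E (cells T E D.down D.up t)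
  bag_root : D.bag T.root = ∅
  bdry_root : famBdry E (cells T E D.down D.up T.root) = ∅
  leaf : ∀ t, t ≠ T.root → T.IsLeaf t → (E \ D.up t).encard ≤ 1
  top_down : ∀ c, T.IsChild T.root c → D.down c = D₀.down c
  top_up : ∀ c, T.IsChild T.root c → ∀ t, T.Below c t → E \ D.up t ⊆ D₀.down c
  depth_le : ∀ t, T.parent t ∈ Q → D.depthAt T t ≤ branchCount T D₀ t

variable {T : RTree N} {E : Set (Sym2 V)} {D₀ D : TreeData N V} {Q : Set N} {x : N}
  {F : N → Set (Sym2 V)}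

namespace RunInv

variable (hI : RunInv T E D₀ Q D)
include hI

theorem down_subset {t : N} (h : t ≠ T.root) : D.down t ⊆ E := by
  have := (hI.part (T.parent t)).subset (.inl t)
  rwa [cells_inl h] at this

theorem up_subset {t : N} (h : t ≠ T.root) : D.up t ⊆ E := by
  have := (hI.part t).subset (.inr false)
  rwa [cells_up h] at this

theorem insert_leaf (hx : T.IsLeaf x) : RunInv T E D₀ (insert x Q) D := by
  -- Considering a leaf adds nothing to the subtree, except that a root without children enters it
  -- through the convention `parent root = root`.
  have key : ∀ t, T.parent t ∈ insert x Q → T.parent t ∈ Q ∨ t = T.root ∧ x = T.root := by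
    rintro t (h | h)
    · by_cases ht : t = T.root
      · refine .inr ⟨ht, ?_⟩
        rw [← h, ht, T.parent_root]
      · exact (hx t ⟨ht, h⟩).elim
    · exact .inl h
  exact
    { hI with
      edge := fun t ht h => hI.edge t ht ((key t h).resolve_right fun h' => ht h'.1)
      up_eq := fun t h => hI.up_eq t fun h' => h (.inr h')
      down_eq := fun t h => hI.down_eq t fun h' => h (.inr h')
      bag_eq := fun t h => by
        rcases key t h with h | ⟨rfl, -⟩
        · exact hI.bag_eq t h
        · rw [hI.bag_root, hI.bdry_root]
      depth_le := fun t h => by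
        rcases key t h with h | ⟨rfl, h⟩
        · exact hI.depth_le t h
        · rw [D.depthAt_root]; exact zero_le }

/-- Cones on exact edges are nested along a path: `down y` and the cone from the parent of `y` to
the grandparent are different cells of one partition, so `down y` avoids the latter. -/
theorem down_subset_of_below (fr : Frontier T Q x) {t : N} (ht : t ≠ T.root) (h : T.Below t x) :
    E \ D.up x ⊆ D.down t := by
  have aux : ∀ y, T.Below t y → T.Below y x → E \ D.up y ⊆ D.down t := by
    intro y
    induction y using T.induction with
    | h0 => intro h _; exact absurd (RTree.below_root h) ht
    | h1 y hy ih =>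
      intro hty hyx
      have hE := hI.edge y hy (fr.parent_mem_of_below hyx hy)
      have hsub : E \ D.up y ⊆ D.down y := by
        rw [← hE]
        rintro e ⟨he | he, he'⟩
        · exact he
        · exact absurd he he'
      rcases RTree.below_iff.1 hty with rfl | hty
      · exact hsub
      · refine Subset.trans ?_ (ih hty ((RTree.parent_below y).trans hyx))
        refine hsub.trans fun e he => mem_sdiff_of_mem (hI.down_subset hy he) fun hu => ?_
        have hp : T.parent y ≠ T.root := fun h => ht (RTree.below_root (h ▸ hty))
        rw [← cells_inl (E := E) (down := D.down) (up := D.up) hy] at he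
        rw [← cells_up (E := E) (down := D.down) (up := D.up) hp] at hu
        cases (hI.part _).eq_of_mem he hu
  exact aux x h (.refl x)

end RunInv

section NewData

variable (hI : RunInv T E D₀ Q D) (fr : Frontier T Q x) (hF : Admissible T E D x F)
include hI fr hF

theorem RunInv.new_part (hx : ¬ T.IsLeaf x) (t : N) :
    IsPartitionOf E (cells T E (newDown T E D (hull T (insert x Q)) x F)
      (newUp T E D (hull T (insert x Q)) x F) t) := by
  rcases Frontier.trichotomy (Q := Q) (x := x) (T := T) t with h | rfl | h | ⟨h, hne⟩ | ⟨h, h'⟩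
  · rw [Frontier.cells_out h]; exact hI.part t
  · rw [fr.cells_self hx hF.other, extCells_eq_redistribute]
    exact (hI.part t).redistribute hF.sumElim_disjoint hF.sumElim_subset
  · rw [Frontier.cells_child h]; exact (hI.part t).shiftTo _ (hF.fStar_subset t)
  · obtain ⟨c, hc, hcx⟩ := RTree.exists_child_below h hne
    rw [fr.cells_below hc hcx]; exact (hI.part t).shiftTo _ hF.iUnion_subset
  · rw [fr.cells_other h h']; exact (hI.part t).shiftTo _ hF.iUnion_subset

theorem RunInv.new_edge {t : N} (ht : t ≠ T.root) (hp : T.parent t ∈ insert x Q) :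
    newDown T E D (hull T (insert x Q)) x F t ∪ newUp T E D (hull T (insert x Q)) x F t = E := by
  have hd := hI.down_subset ht
  have hu := hI.up_subset ht
  have hFE := hF.iUnion_subset
  have below : T.Below t x →
      newDown T E D (hull T (insert x Q)) x F t ∪ newUp T E D (hull T (insert x Q)) x F t = E := by
    intro h
    have hE := hI.edge t ht (fr.parent_mem_of_below h ht)
    rw [fr.newDown_below ht h, fr.newUp_below ht h]
    ext e
    constructor
    · rintro ((he | he) | he)
      · exact hd he
      · exact hFE he
      · exact hu he.1
    · intro he
      by_cases heF : e ∈ ⋃ d, F d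
      · exact .inl (.inr heF)
      · rw [← hE] at he
        exact he.imp .inl fun h => ⟨h, heF⟩
  rcases Frontier.trichotomy (Q := Q) (x := x) (T := T) t with h | rfl | h | ⟨h, hne⟩ | ⟨h, h'⟩
  · exact absurd hp h
  · exact below (.refl t)
  -- The edges in neither cone of this tree edge are split up: those in `F t` go down, all others go
  -- up with `fStar`.
  · rw [fr.newDown_child h, Frontier.newUp_child h]
    have hFt : F t ⊆ ⋃ d, F d := subset_iUnion F t
    ext e
    have h1 := @hd e
    have h2 := @hu e
    have h3 := @hFE e
    have h4 := @hFt e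
    simp only [fStar, mem_union, mem_sdiff, mem_inter_iff]
    tauto
  · exact below h
  · have hE := hI.edge t ht h
    rw [Frontier.newDown_other ht (.inr (fr.closed _ h)) (ne_of_mem_of_not_mem h fr.notMem)
      (fr.not_isChild_of_mem h) h', fr.newUp_other ht h h']
    ext e
    constructor
    · rintro (he | he | he)
      · exact hd he.1
      · exact hu he
      · exact hFE he
    · intro he
      by_cases heF : e ∈ ⋃ d, F d
      · exact .inr (.inr heF)
      · rw [← hE] at he
        exact he.imp (fun h => ⟨h, heF⟩) .inl

theorem RunInv.new_disj {t : N} (ht : t ≠ T.root) :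
    Disjoint (newDown T E D (hull T (insert x Q)) x F t)
      (newUp T E D (hull T (insert x Q)) x F t) := by
  have hdu := disjoint_left.1 (hI.disj t ht)
  have below : T.Below t x → Disjoint (newDown T E D (hull T (insert x Q)) x F t)
      (newUp T E D (hull T (insert x Q)) x F t) := by
    intro h
    rw [fr.newDown_below ht h, fr.newUp_below ht h, disjoint_left]
    rintro e (he | he) he'
    · exact hdu he he'.1
    · exact he'.2 he
  rcases Frontier.trichotomy (Q := Q) (x := x) (T := T) t with h | rfl | h | ⟨h, hne⟩ | ⟨h, h'⟩
  · rw [Frontier.newUp_out h]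
    exact (hI.disj t ht).mono_left (fr.newDown_subset ht h)
  · exact below (.refl t)
  · rw [fr.newDown_child h, Frontier.newUp_child h, disjoint_left]
    rintro e (he | he) (he' | he')
    · exact hdu he.1 he'
    · rcases he'.1 with h | h
      · exact h.2.2 he.1
      · exact he.2 h
    · exact (hF.child t h he).1.2 he'
    · exact he'.2 he
  · exact below h
  · rw [Frontier.newDown_other ht (.inr (fr.closed _ h)) (ne_of_mem_of_not_mem h fr.notMem)
      (fr.not_isChild_of_mem h) h', fr.newUp_other ht h h', disjoint_left]
    rintro e he (he' | he')
    · exact hdu he.1 he'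
    · exact he.2 he'

omit hI hF in
/-- The cone towards the parent shrinks only on the path to `x`. -/
theorem Frontier.up_subset_newUp {t : N} (ht : t ≠ T.root) (h : ¬ T.Below t x) :
    D.up t ⊆ newUp T E D (hull T (insert x Q)) x F t := by
  rcases Frontier.trichotomy (Q := Q) (x := x) (T := T) t with h' | rfl | h' | ⟨h', -⟩ | ⟨h', -⟩
  · rw [Frontier.newUp_out h']
  · exact absurd (.refl t) h
  · rw [Frontier.newUp_child h']; exact subset_union_left
  · exact absurd h' h
  · rw [fr.newUp_other ht h' h]; exact subset_union_left

omit fr in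
/-- The sets `F_c` stay within the connected component of `x`. -/
theorem RunInv.iUnion_subset_top {c : N} (hc : T.IsChild T.root c) (hcx : T.Below c x) :
    ⋃ d, F d ⊆ D₀.down c := by
  refine Set.iUnion_subset fun d => ?_
  by_cases hd : T.IsChild x d
  · exact fun e he => hI.top_up c hc d (hcx.trans (hd.2 ▸ RTree.parent_below d))
      (hF.child d hd he).1
  · simp [hF.other d hd]

omit fr in
-- At the root there is no gap to fill: an edge outside `up d` already lies in the component `down
-- d`.
theorem RunInv.iUnion_eq_empty (hx : x = T.root) : ⋃ d, F d = ∅ := by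
  refine Set.iUnion_eq_empty.2 fun d => ?_
  by_cases hd : T.IsChild x d
  · refine eq_empty_of_forall_notMem fun e he => (hF.child d hd he).2.2 ?_
    rw [hI.top_down d (hx ▸ hd)]
    exact hI.top_up d (hx ▸ hd) d (.refl d) (hF.child d hd he).1
  · exact hF.other d hd

/-- All moved edges lie in the component containing `x`; its cone has them already, and the cones of
the other components are disjoint from them. -/
theorem RunInv.new_top_down {c : N} (hc : T.IsChild T.root c) :
    newDown T E D (hull T (insert x Q)) x F c = D.down c := by
  by_cases hx : x = T.root
  · have hU := hI.iUnion_eq_empty hF hx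
    have hFc : F c = ∅ := Set.iUnion_eq_empty.1 hU c
    rw [fr.newDown_child (hx ▸ hc), hU, hFc]
    simp
  · obtain ⟨a, ha, hax⟩ := RTree.exists_child_below (RTree.root_below x) (Ne.symm hx)
    have hU := hI.iUnion_subset_top hF ha hax
    rw [← hI.top_down a ha] at hU
    by_cases hcx : T.Below c x
    · rw [fr.newDown_below hc.1 hcx]
      rw [ha.eq_of_below hc hax hcx] at hU
      exact union_eq_self_of_subset_right hU
    · have hpp : T.parent (T.parent c) ∈ insert x Q := by
        rw [hc.2]
        exact fr.mem_insert_of_below (RTree.root_below x |>.trans (.refl x) |> fun h =>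
          (RTree.parent_below _).trans h) (.inl rfl)
      rw [Frontier.newDown_other hc.1 hpp (by rw [hc.2]; exact Ne.symm hx)
        (by rw [hc.2]; exact fun h => h.1 rfl) hcx]
      refine sdiff_eq_left.2 (Disjoint.mono_right hU ?_)
      have hac : (Sum.inl c : N ⊕ Bool) ≠ .inl a := by
        intro h; cases h; exact hcx hax
      have := (hI.part T.root).2 hac
      rw [← hc.2, cells_inl hc.1, hc.2, ← ha.2, cells_inl ha.1] at this
      exact this

theorem RunInv.new_top_up {c : N} (hc : T.IsChild T.root c) {t : N} (hct : T.Below c t) :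
    E \ newUp T E D (hull T (insert x Q)) x F t ⊆ D₀.down c := by
  have ht : t ≠ T.root := by rintro rfl; exact hc.1 (RTree.below_root hct)
  by_cases htx : T.Below t x
  · rw [fr.newUp_below ht htx]
    rintro e ⟨he, he'⟩
    by_cases heF : e ∈ ⋃ d, F d
    · exact hI.iUnion_subset_top hF hc (hct.trans htx) heF
    · exact hI.top_up c hc t hct ⟨he, fun h => he' ⟨h, heF⟩⟩
  · exact (sdiff_subset_sdiff_right (fr.up_subset_newUp ht htx)).trans
      (hI.top_up c hc t hct)

theorem RunInv.new_bdry_root :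
    famBdry E (cells T E (newDown T E D (hull T (insert x Q)) x F)
      (newUp T E D (hull T (insert x Q)) x F) T.root) = ∅ := by
  have hcells : cells T E (newDown T E D (hull T (insert x Q)) x F)
      (newUp T E D (hull T (insert x Q)) x F) T.root = cells T E D.down D.up T.root := by
    funext j
    rcases j with c | _ | _
    · ext e
      refine and_congr_right fun hc => ?_
      rw [hI.new_top_down fr hF hc]
    · simp [cells]
    · simp [cells]
  rw [hcells, hI.bdry_root]

omit hI fr hF in
theorem newData_bag {t : N} (h : T.parent t ∈ insert x Q) :
    (newData T E D (hull T (insert x Q)) x F).bag t =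
      famBdry E (cells T E (newDown T E D (hull T (insert x Q)) x F)
        (newUp T E D (hull T (insert x Q)) x F) t) :=
  if_pos h

/-- Optimality of the choice at `x` bounds the bags on the path to `x`. -/
theorem RunInv.encard_new_bag_le [Finite V] (hx : ¬ T.IsLeaf x) (hopt : Optimal T E D x F)
    {t : N} (ht : t ≠ T.root) (h : T.Below t x) :
    ((newData T E D (hull T (insert x Q)) x F).bag t).encard ≤ (D.bag t).encard := by
  have hpQ := fr.parent_mem_of_below h ht
  rw [newData_bag (.inr hpQ), hI.bag_eq t hpQ]
  by_cases htx : t = x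
  · subst htx
    rw [fr.cells_self hx hF.other]
    -- At `x` itself the competitor is the empty choice, which leaves the old cells.
    refine (hopt.min_bdry (fun c => F c ∩ ∅) (hF.inter ∅)).trans_eq ?_
    congr 2
    funext j
    rcases j with c | _ <;> simp [extCells]
  · obtain ⟨c, hc, hcx⟩ := RTree.exists_child_below h htx
    have hxr : x ≠ T.root := by rintro rfl; exact htx (RTree.below_root h)
    have hcA : cells T E D.down D.up t (.inl c) = D.down c := by
      rw [← hc.2, cells_inl hc.1]
    have hG : (⋃ j, (Sum.elim F (fun _ => ∅) : N ⊕ Bool → Set (Sym2 V)) j) = ⋃ c, F c := by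
      ext e; simp
    have hPR : ∀ i, i ≠ .inr false →
        cells T E D.down D.up x i ⊆ cells T E D.down D.up t (.inl c) := by
      intro i hi e he
      rw [hcA]
      refine hI.down_subset_of_below fr hc.1 hcx ⟨(hI.part x).subset i he, fun hu => hi ?_⟩
      rw [← cells_up (E := E) (down := D.down) (up := D.up) hxr] at hu
      exact (hI.part x).eq_of_mem he hu
    -- Uncrossing the partition at `x` with that at `t`: the alternative choice `F d ∩ D.down c` is
    -- admissible, hence no better than `F`, and cancelling leaves the bound for the bag of `t`.
    have key := encard_famBdry_uncross (hI.part x) (hI.part t) hPR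
      (H := Sum.elim F fun _ => ∅) rfl hF.sumElim_disjoint hF.sumElim_subset
    rw [hG, hcA, ← extCells_eq_redistribute] at key
    have halt : (redistribute (cells T E D.down D.up x) fun i =>
        (Sum.elim F (fun _ => ∅) : N ⊕ Bool → Set (Sym2 V)) i ∩ D.down c) =
        extCells T E D x fun d => F d ∩ D.down c := by
      rw [extCells_eq_redistribute]
      congr 1
      funext j
      rcases j with d | _ <;> simp
    rw [halt] at key
    have hmin := hopt.min_bdry _ (hF.inter (D.down c))
    rw [fr.cells_below hc hcx]
    -- Cancellation in `ℕ∞` needs a finite term.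
    have hfin : (famBdry E (extCells T E D x F)).encard ≠ ⊤ :=
      (Set.toFinite _).encard_lt_top.ne
    exact (ENat.add_le_add_iff_left hfin).1 ((add_le_add_left hmin _).trans key)

/-- On the path to `x` a dropped vertex is a boundary vertex at the parent that misses the cone
towards `x`. That cone gains edges, so each set of dropped vertices shrinks. -/
theorem RunInv.new_codepth_le (hx : ¬ T.IsLeaf x) {t : N} (h : T.Below t x) :
    (newData T E D (hull T (insert x Q)) x F).codepthAt T t ≤ D.codepthAt T t := by
  induction t using T.induction with
  | h0 => rw [TreeData.codepthAt_root]; exact zero_le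
  | h1 t ht ih =>
    have hp := (RTree.parent_below t).trans h
    have hpQ := fr.parent_mem_of_below h ht
    rw [TreeData.codepthAt_of_ne _ ht, TreeData.codepthAt_of_ne _ ht]
    refine add_le_add (ih hp) (encard_le_encard ?_)
    rw [newData_bag (.inr hpQ), newData_bag (.inr (fr.closed _ hpQ)), hI.bag_eq t hpQ,
      hI.bag_eq _ (fr.closed _ hpQ),
      famBdry_parent_diff (hI.new_part fr hF hx _) (hI.new_part fr hF hx t) ht
        (hI.new_disj fr hF ht) (hI.new_edge fr hF ht (.inr hpQ)),
      famBdry_parent_diff (hI.part _) (hI.part t) ht (hI.disj t ht) (hI.edge t ht hpQ)]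
    rintro v ⟨hv, hv'⟩
    have hsh := fr.cells_below (E := E) (D := D) (F := F) ⟨ht, rfl⟩ h
    rw [← cells_inl (E := E) (down := newDown T E D (hull T (insert x Q)) x F)
      (up := newUp T E D (hull T (insert x Q)) x F) ht, hsh] at hv'
    rw [hsh] at hv
    have := mem_of_mem_famBdry_shiftTo (hI.part _) hF.iUnion_subset hv hv'
    rwa [cells_inl ht] at this

/-- The root bag is empty before and after the step, so the depth is bag size plus codepth, and
neither grows. -/
theorem RunInv.new_depth_le_of_below [Finite V] (hx : ¬ T.IsLeaf x) (hopt : Optimal T E D x F)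
    {t : N} (h : T.Below t x) :
    (newData T E D (hull T (insert x Q)) x F).depthAt T t ≤ D.depthAt T t := by
  by_cases ht : t = T.root
  · rw [ht, TreeData.depthAt_root]; exact zero_le
  have hroot : T.parent T.root ∈ insert x Q := by
    rw [T.parent_root]; exact fr.mem_insert_of_below (RTree.root_below x) (.inl rfl)
  have h1 := (newData T E D (hull T (insert x Q)) x F).depthAt_add_encard_bag_root (T := T) t
  have h2 := D.depthAt_add_encard_bag_root (T := T) t
  rw [newData_bag hroot, hI.new_bdry_root fr hF, encard_empty, add_zero] at h1
  rw [hI.bag_root, encard_empty, add_zero] at h2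
  rw [h1, h2]
  exact add_le_add (hI.encard_new_bag_le fr hF hx hopt ht h) (hI.new_codepth_le fr hF hx h)

/-- Off the path to `x` the moved edges enter the cone to the parent, so the set of new vertices,
those missing this cone, shrinks term by term. -/
theorem RunInv.new_depth_le_of_mem [Finite V] (hx : ¬ T.IsLeaf x) (hopt : Optimal T E D x F)
    {t : N} (h : T.parent t ∈ Q) :
    (newData T E D (hull T (insert x Q)) x F).depthAt T t ≤ D.depthAt T t := by
  induction t using T.induction with
  | h0 => rw [TreeData.depthAt_root]; exact zero_le
  | h1 t ht ih =>
    by_cases hb : T.Below t x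
    · exact hI.new_depth_le_of_below fr hF hx hopt hb
    rw [TreeData.depthAt_of_ne _ ht, TreeData.depthAt_of_ne _ ht]
    refine add_le_add (ih (fr.closed _ h)) (encard_le_encard ?_)
    rw [newData_bag (.inr h), newData_bag (.inr (fr.closed _ h)), hI.bag_eq t h,
      hI.bag_eq _ (fr.closed _ h),
      famBdry_diff_parent (hI.new_part fr hF hx _) (hI.new_part fr hF hx t) ht
        (hI.new_disj fr hF ht) (hI.new_edge fr hF ht (.inr h)),
      famBdry_diff_parent (hI.part _) (hI.part t) ht (hI.disj t ht) (hI.edge t ht h)]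
    rintro v ⟨hv, hv'⟩
    have hsh := fr.cells_other (E := E) (D := D) (F := F) h hb
    rw [← cells_up (E := E) (down := newDown T E D (hull T (insert x Q)) x F)
      (up := newUp T E D (hull T (insert x Q)) x F) ht, hsh] at hv'
    rw [hsh] at hv
    have := mem_of_mem_famBdry_shiftTo (hI.part _) hF.iUnion_subset hv hv'
    rwa [cells_up ht] at this

/-- A vertex that is new at a child of `x` is a new vertex of the escape space in `D₀`. -/
theorem RunInv.new_diff_subset (hs : Steady T D₀) (hx : ¬ T.IsLeaf x) {t : N}
    (ht : T.IsChild x t) {v : V}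
    (hv : v ∈ (newData T E D (hull T (insert x Q)) x F).bag t \
      (newData T E D (hull T (insert x Q)) x F).bag x) :
    v ∈ D₀.bag t ∧ v ∉ D₀.bag x ∧ Inc (D₀.down t) v := by
  have htS : T.parent t ∈ insert x Q := .inl ht.2
  have hxS : T.parent x ∈ insert x Q :=
    fr.mem_insert_of_below (RTree.parent_below x) (.inl rfl)
  have htQ : T.parent t ∉ Q := ht.2.symm ▸ fr.notMem
  rw [newData_bag htS, newData_bag hxS] at hv
  have hd := famBdry_diff_parent (hI.new_part fr hF hx _) (hI.new_part fr hF hx t) ht.1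
    (hI.new_disj fr hF ht.1) (hI.new_edge fr hF ht.1 htS)
  rw [ht.2] at hd
  obtain ⟨hv, hv'⟩ := hd.subset hv
  have hsh := Frontier.cells_child (Q := Q) (E := E) (D := D) (F := F) ht
  rw [← cells_up (E := E) (down := newDown T E D (hull T (insert x Q)) x F)
    (up := newUp T E D (hull T (insert x Q)) x F) ht.1, hsh] at hv'
  rw [hsh] at hv
  obtain ⟨hv, hvu⟩ := mem_of_mem_famBdry_shiftTo (hI.part _) (hF.fStar_subset t) hv hv'
  obtain ⟨i, j, hij, hi, hj⟩ := exists_inc_of_mem_famBdry (hI.part t) hv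
  -- Both cells at `v` belong to children: the cone to the parent is excluded by `hvu`, and a leaf
  -- has only one other cell. The cones of these grandchildren of `x` are still the original ones.
  have hchild : ∀ {i j}, i ≠ j → Inc (cells T E D.down D.up t i) v →
      Inc (cells T E D.down D.up t j) v →
      ∃ c, i = .inl c ∧ T.IsChild t c ∧ Inc (D₀.down c) v := by
    intro i j hij hi hj
    rcases i with c | _ | _
    · obtain ⟨e, he, hev⟩ := hi
      refine ⟨c, rfl, he.1, e, ?_, hev⟩
      rw [← hI.down_eq c]
      · exact he.2
      · rwa [he.1.2]
    · exact absurd hi hvu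
    · rcases j with c | _ | _
      · obtain ⟨e, he, -⟩ := hi
        obtain ⟨f, hf, -⟩ := hj
        exact absurd hf.1 (he.2.1 c)
      · exact absurd hj hvu
      · exact absurd rfl hij
  obtain ⟨c, rfl, hc, hci⟩ := hchild hij hi hj
  obtain ⟨d, rfl, hd, hdi⟩ := hchild hij.symm hj hi
  rw [cells_up ht.1, hI.up_eq t htQ] at hvu
  have := hs.separated ht.1 hc hd (fun h => hij (congrArg _ h)) hci hdi hvu
  rwa [ht.2] at this

/-- Only the children of `x` join the subtree. Such a child adds nothing to the depth at `x` unless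
it is branching, and then at most one. -/
theorem RunInv.new_depth_le [Finite V] (hs : Steady T D₀) (hx : ¬ T.IsLeaf x)
    (hopt : Optimal T E D x F) {t : N} (h : T.parent t ∈ insert x Q) :
    (newData T E D (hull T (insert x Q)) x F).depthAt T t ≤ branchCount T D₀ t := by
  by_cases ht : t = T.root
  · rw [ht, TreeData.depthAt_root]; exact zero_le
  rcases h with h | h
  swap
  · exact (hI.new_depth_le_of_mem fr hF hx hopt h).trans (hI.depth_le t h)
  have htc : T.IsChild x t := ⟨ht, h⟩
  have hxd : (newData T E D (hull T (insert x Q)) x F).depthAt T x ≤ branchCount T D₀ x := by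
    rcases fr.parent_mem with hx' | hx'
    · rw [hx', TreeData.depthAt_root]; exact zero_le
    · exact (hI.new_depth_le_of_below fr hF hx hopt (.refl x)).trans (hI.depth_le x hx')
  rw [TreeData.depthAt_of_ne _ ht, h]
  by_cases hne : ((newData T E D (hull T (insert x Q)) x F).bag t \
      (newData T E D (hull T (insert x Q)) x F).bag x) = ∅
  · rw [hne, encard_empty, add_zero]
    exact hxd.trans (branchCount_mono (h ▸ RTree.parent_below t))
  · obtain ⟨v, hv⟩ := nonempty_iff_ne_empty.2 hne
    obtain ⟨h1, h2, h3⟩ := hI.new_diff_subset fr hF hs hx htc hv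
    have hbr : D₀.IsBranching T t := ⟨ht, v, h1, h.symm ▸ h2, h3⟩
    have hle : ((newData T E D (hull T (insert x Q)) x F).bag t \
      (newData T E D (hull T (insert x Q)) x F).bag x).encard ≤ 1 := by
      refine (encard_le_encard fun w hw => ?_).trans (hs.new_le_one t ht)
      obtain ⟨h1, h2, -⟩ := hI.new_diff_subset fr hF hs hx htc hw
      exact ⟨h1, h.symm ▸ h2⟩
    refine (add_le_add hxd hle).trans ?_
    have hnot : t ∉ {u | T.Below u x ∧ D₀.IsBranching T u} := fun hu => htc.not_below hu.1
    rw [branchCount, ← encard_insert_of_notMem hnot]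
    refine encard_le_encard (insert_subset ⟨.refl t, hbr⟩ fun u hu => ⟨?_, hu.2⟩)
    exact hu.1.trans (h ▸ RTree.parent_below t)

end NewData

theorem RunInv.insert_newData [Finite V] (hs : Steady T D₀) (hI : RunInv T E D₀ Q D)
    (fr : Frontier T Q x) (hx : ¬ T.IsLeaf x) (hopt : Optimal T E D x F) :
    RunInv T E D₀ (insert x Q) (newData T E D (hull T (insert x Q)) x F) where
  part := hI.new_part fr hopt.adm hx
  disj t ht := hI.new_disj fr hopt.adm ht
  edge t ht h := hI.new_edge fr hopt.adm ht h
  up_eq t h := (Frontier.newUp_out h).trans (hI.up_eq t fun h' => h (.inr h'))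
  down_eq t h := (Frontier.newDown_out h).trans (hI.down_eq t fun h' => h (.inr h'))
  bag_eq t h := newData_bag h
  bag_root := by
    have hroot : T.parent T.root ∈ insert x Q := by
      rw [T.parent_root]; exact fr.mem_insert_of_below (RTree.root_below x) (.inl rfl)
    rw [newData_bag hroot]
    exact hI.new_bdry_root fr hopt.adm
  bdry_root := hI.new_bdry_root fr hopt.adm
  leaf t ht hl := by
    -- The inner node `x` has no leaf on its path, so the cone from `t` to its parent does not
    -- shrink.
    have hb : ¬ T.Below t x := fun h => by
      obtain ⟨c, hc, -⟩ := RTree.exists_child_below h (by rintro rfl; exact hx hl)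
      exact hl c hc
    exact (encard_le_encard (sdiff_subset_sdiff_right
      (fr.up_subset_newUp ht hb))).trans (hI.leaf t ht hl)
  top_down c hc := (hI.new_top_down fr hopt.adm hc).trans (hI.top_down c hc)
  top_up c hc t h := hI.new_top_up fr hopt.adm hc h
  depth_le t h := hI.new_depth_le fr hopt.adm hs hx hopt h

end Invariant

/-! ### Edge components -/

section EdgeComp

variable {V : Type*} {E : Set (Sym2 V)} {X Y : Set V} {e f g : Sym2 V}

theorem mem_edgeComp_self (he : e ∈ E) : e ∈ edgeComp E X e := ⟨he, .inl rfl⟩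

theorem deleteVerts_mono (h : X ⊆ Y) : deleteVerts E Y ≤ deleteVerts E X :=
  fun _ _ huv => ⟨huv.1, huv.2.1, fun hu => huv.2.2.1 (h hu), fun hv => huv.2.2.2 (h hv)⟩

theorem edgeComp_anti (h : X ⊆ Y) (e : Sym2 V) : edgeComp E Y e ⊆ edgeComp E X e := by
  rintro f ⟨hf, rfl | ⟨u, hu, v, hv, huX, hvX, hr⟩⟩
  · exact ⟨hf, .inl rfl⟩
  · exact ⟨hf, .inr ⟨u, hu, v, hv, fun h' => huX (h h'), fun h' => hvX (h h'),
      hr.mono (deleteVerts_mono h)⟩⟩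

theorem reachable_of_mem {u v : V} (he : e ∈ E) (hu : u ∈ e) (hv : v ∈ e) (huX : u ∉ X)
    (hvX : v ∉ X) : (deleteVerts E X).Reachable u v := by
  by_cases h : u = v
  · rw [h]
  · have : e = s(u, v) := (Sym2.mem_and_mem_iff h).1 ⟨hu, hv⟩
    exact SimpleGraph.Adj.reachable ⟨h, this ▸ he, huX, hvX⟩

theorem edgeComp_subset_of_mem (hf : f ∈ edgeComp E X e) :
    edgeComp E X f ⊆ edgeComp E X e := by
  rintro g ⟨hg, rfl | ⟨u, hu, v, hv, huX, hvX, hr⟩⟩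
  · exact hf
  · obtain ⟨hfE, rfl | ⟨a, ha, b, hb, haX, hbX, hr'⟩⟩ := hf
    · exact ⟨hg, .inr ⟨u, hu, v, hv, huX, hvX, hr⟩⟩
    · exact ⟨hg, .inr ⟨a, ha, v, hv, haX, hvX,
        (hr'.trans (reachable_of_mem hfE hb hu hbX huX)).trans hr⟩⟩

theorem mem_edgeComp_symm (he : e ∈ E) (hf : f ∈ edgeComp E X e) : e ∈ edgeComp E X f := by
  obtain ⟨-, rfl | ⟨a, ha, b, hb, haX, hbX, hr⟩⟩ := hf
  · exact mem_edgeComp_self he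
  · exact ⟨he, .inr ⟨b, hb, a, ha, hbX, haX, hr.symm⟩⟩

theorem edgeComp_eq_of_mem (he : e ∈ E) (hf : f ∈ edgeComp E X e) :
    edgeComp E X f = edgeComp E X e :=
  (edgeComp_subset_of_mem hf).antisymm (edgeComp_subset_of_mem (mem_edgeComp_symm he hf))

theorem edgeComp_eq_singleton (he : e ∈ E) (h : ∀ v ∈ e, v ∈ X) : edgeComp E X e = {e} := by
  ext f
  constructor
  · rintro ⟨-, rfl | ⟨u, hu, -, -, huX, -⟩⟩
    · rfl
    · exact absurd (h u hu) huX
  · rintro rfl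
    exact mem_edgeComp_self he

theorem edgeComps_eq {R : Set (Sym2 V)} (hR : R ∈ edgeComps E X) (he : e ∈ R) :
    e ∈ E ∧ R = edgeComp E X e := by
  obtain ⟨f, hf, rfl⟩ := hR
  exact ⟨he.1, (edgeComp_eq_of_mem hf he).symm⟩

theorem edgeComps_nonempty {R : Set (Sym2 V)} (hR : R ∈ edgeComps E X) : R.Nonempty := by
  obtain ⟨e, he, rfl⟩ := hR
  exact ⟨e, mem_edgeComp_self he⟩

theorem edgeComps_subset {R : Set (Sym2 V)} (hR : R ∈ edgeComps E X) : R ⊆ E := by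
  obtain ⟨f, hf, rfl⟩ := hR
  exact fun e he => he.1

theorem edgeComps_eq_of_mem {R S : Set (Sym2 V)} (hR : R ∈ edgeComps E X)
    (hS : S ∈ edgeComps E X) (heR : e ∈ R) (heS : e ∈ S) : R = S := by
  rw [(edgeComps_eq hR heR).2, (edgeComps_eq hS heS).2]

/-- Loops identify edge components: the component of every edge at an unoccupied vertex contains the
loop there, whereas the loop at an occupied vertex is a component by itself
(`eq_singleton_of_loop_mem`). -/
theorem loop_mem_edgeComps {R : Set (Sym2 V)} (hR : R ∈ edgeComps E X) {v : V} (hv : Inc R v)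
    (hvX : v ∉ X) (hl : s(v, v) ∈ E) : s(v, v) ∈ R := by
  obtain ⟨e, he, hev⟩ := hv
  rw [(edgeComps_eq hR he).2]
  exact ⟨hl, .inr ⟨v, hev, v, Sym2.mem_mk_left v v, hvX, hvX, .refl v⟩⟩

theorem eq_singleton_of_loop_mem {R : Set (Sym2 V)} (hR : R ∈ edgeComps E X) {v : V}
    (hvX : v ∈ X) (hl : s(v, v) ∈ R) : R = {s(v, v)} := by
  obtain ⟨hE, h⟩ := edgeComps_eq hR hl
  rw [h]
  refine edgeComp_eq_singleton hE fun w hw => ?_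
  rw [Sym2.mem_iff, or_self] at hw
  rwa [hw]

end EdgeComp

/-! ### The strategy tree -/

namespace CopStrategy

variable {V : Type*} {E : Set (Sym2 V)} {k : ℕ} {σ : CopStrategy E k}

theorem pos_cons_caught {R : Set (Sym2 V)} {l : List (Set (Sym2 V))} (h : Caught (σ.pos l) R) :
    σ.pos (R :: l) = {v | ∃ e ∈ R, v ∈ e} := by
  rw [pos, if_pos h]

theorem pos_cons {R : Set (Sym2 V)} {l : List (Set (Sym2 V))} (h : ¬ Caught (σ.pos l) R) :
    σ.pos (R :: l) = σ.moveOn (σ.pos l) R := by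
  rw [pos, if_neg h]

theorem pos_cons_subset {R : Set (Sym2 V)} {l : List (Set (Sym2 V))} (h : Caught (σ.pos l) R) :
    σ.pos (R :: l) ⊆ σ.pos l := by
  rw [pos_cons_caught h]
  obtain ⟨e, rfl, he⟩ := h
  rintro v ⟨f, rfl, hv⟩
  exact he v hv

theorem moveOn_eq {X : Set V} {R : Set (Sym2 V)} {e : Sym2 V} (hX : X.encard ≤ (k : ℕ∞))
    (hR : R ∈ edgeComps E X) (he : e ∈ R) : σ.moveOn X R = σ.move X e := by
  obtain ⟨heE, hRe⟩ := edgeComps_eq hR he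
  ext v
  constructor
  · rintro ⟨f, hf, hv⟩
    rw [← σ.const X e f hX heE (hRe ▸ hf)]
    exact hv
  · exact fun hv => ⟨e, he, hv⟩

theorem IsNode.mem_edgeComps {R : Set (Sym2 V)} {l : List (Set (Sym2 V))}
    (h : σ.IsNode (R :: l)) : R ∈ edgeComps E (σ.pos l) := by
  cases h with
  | first _ h => exact h
  | step _ R' l _ _ h _ => exact h

theorem encard_pos_le {l : List (Set (Sym2 V))} (h : σ.IsNode l) :
    (σ.pos l).encard ≤ (k : ℕ∞) := by
  induction l with
  | nil => simp [pos]
  | cons R l ih =>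
    have hl := ih h.tail
    by_cases hc : Caught (σ.pos l) R
    · exact (encard_le_encard (pos_cons_subset hc)).trans hl
    · obtain ⟨e, he⟩ := edgeComps_nonempty h.mem_edgeComps
      rw [pos_cons hc, moveOn_eq hl h.mem_edgeComps he]
      exact σ.card_le _ _ hl (edgeComps_subset h.mem_edgeComps he)

theorem encard_pos_diff_le {R : Set (Sym2 V)} {l : List (Set (Sym2 V))}
    (h : σ.IsNode (R :: l)) : (σ.pos (R :: l) \ σ.pos l).encard ≤ 1 := by
  by_cases hc : Caught (σ.pos l) R
  · rw [sdiff_eq_empty.2 (pos_cons_subset hc)]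
    simp
  · obtain ⟨e, he⟩ := edgeComps_nonempty h.mem_edgeComps
    have hl : (σ.pos l).encard ≤ (k : ℕ∞) := encard_pos_le h.tail
    rw [pos_cons hc, moveOn_eq hl h.mem_edgeComps he]
    rcases σ.legal _ e hl (edgeComps_subset h.mem_edgeComps he) with h | ⟨v, h⟩
    · rw [sdiff_eq_empty.2 h]
      simp
    · rw [h]
      refine (encard_le_encard (t := {v}) ?_).trans (encard_singleton v).le
      rintro w ⟨rfl | hw, hw'⟩
      · rfl
      · exact absurd hw hw'

theorem isChild_iff {t c : σ.Node} :
    σ.tree.IsChild t c ↔ ∃ R, c.1 = R :: t.1 := by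
  constructor
  · rintro ⟨hc, rfl⟩
    obtain ⟨l, hl⟩ := c
    cases l with
    | nil => exact absurd rfl hc
    | cons R l => exact ⟨R, rfl⟩
  · rintro ⟨R, hR⟩
    refine ⟨?_, Subtype.ext ?_⟩
    · rintro rfl
      cases hR
    · change c.1.tail = t.1
      rw [hR, List.tail_cons]

theorem exists_cons {t : σ.Node} (ht : t ≠ σ.tree.root) :
    ∃ R l, t.1 = R :: l ∧ (σ.tree.parent t).1 = l ∧ σ.coneDown t = R := by
  obtain ⟨l, hl⟩ := t
  cases l with
  | nil => exact absurd rfl ht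
  | cons R l => exact ⟨R, l, rfl, rfl, rfl⟩

theorem coneDown_mem_of_isChild {t c : σ.Node} (h : σ.tree.IsChild t c) :
    σ.coneDown c ∈ edgeComps E (σ.pos t.1) := by
  obtain ⟨R, hR⟩ := isChild_iff.1 h
  have := c.2
  rw [hR] at this
  simpa [coneDown, hR] using this.mem_edgeComps

theorem coneDown_mem {t : σ.Node} (ht : t ≠ σ.tree.root) :
    σ.coneDown t ∈ edgeComps E (σ.pos (σ.tree.parent t).1) :=
  coneDown_mem_of_isChild ⟨ht, rfl⟩

theorem coneDown_subset (t : σ.Node) : σ.coneDown t ⊆ E := by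
  by_cases ht : t = σ.tree.root
  · subst ht; exact empty_subset _
  · exact edgeComps_subset (coneDown_mem ht)

theorem eq_of_coneDown_eq {t c d : σ.Node} (hc : σ.tree.IsChild t c) (hd : σ.tree.IsChild t d)
    (h : σ.coneDown c = σ.coneDown d) : c = d := by
  obtain ⟨R, hR⟩ := isChild_iff.1 hc
  obtain ⟨S, hS⟩ := isChild_iff.1 hd
  simp only [coneDown, hR, hS, List.headD_cons] at h
  exact Subtype.ext (by rw [hR, hS, h])

theorem eq_of_mem_coneDown {t c d : σ.Node} (hc : σ.tree.IsChild t c)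
    (hd : σ.tree.IsChild t d) {e : Sym2 V} (hec : e ∈ σ.coneDown c) (hed : e ∈ σ.coneDown d) :
    c = d :=
  eq_of_coneDown_eq hc hd
    (edgeComps_eq_of_mem (coneDown_mem_of_isChild hc) (coneDown_mem_of_isChild hd) hec hed)

theorem exists_child_root {e : Sym2 V} (he : e ∈ E) :
    ∃ c : σ.Node, σ.tree.IsChild σ.tree.root c ∧ σ.coneDown c = edgeComp E ∅ e :=
  ⟨⟨[edgeComp E ∅ e], .first _ ⟨e, he, rfl⟩⟩, isChild_iff.2 ⟨_, rfl⟩, rfl⟩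

theorem exists_child {t : σ.Node} (ht : t ≠ σ.tree.root)
    (hc : ¬ Caught (σ.pos (σ.tree.parent t).1) (σ.coneDown t)) {e : Sym2 V}
    (he : e ∈ σ.coneDown t) : ∃ c : σ.Node, σ.tree.IsChild t c ∧ e ∈ σ.coneDown c := by
  obtain ⟨R, l, h1, h2, h3⟩ := exists_cons ht
  have heE := coneDown_subset t he
  rw [h2, h3] at hc
  rw [h3] at he
  have ht2 := t.2
  rw [h1] at ht2
  exact ⟨⟨edgeComp E (σ.pos (R :: l)) e :: R :: l, .step _ _ _ ht2 hc ⟨e, heE, rfl⟩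
    ⟨e, mem_edgeComp_self heE, he⟩⟩, isChild_iff.2 ⟨_, by rw [h1]⟩, mem_edgeComp_self heE⟩

theorem child_spec {t c : σ.Node} (ht : t ≠ σ.tree.root) (h : σ.tree.IsChild t c) :
    ¬ Caught (σ.pos (σ.tree.parent t).1) (σ.coneDown t) ∧
      (σ.coneDown c ∩ σ.coneDown t).Nonempty := by
  obtain ⟨R, l, h1, h2, h3⟩ := exists_cons ht
  obtain ⟨S, hS⟩ := isChild_iff.1 h
  have hc2 := c.2
  have hcS : σ.coneDown c = S := by simp [coneDown, hS]
  rw [hS, h1] at hc2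
  rw [h2, h3, hcS]
  cases hc2 with
  | step _ _ _ _ h1 _ h3 => exact ⟨h1, h3⟩

theorem caught_of_isLeaf {t : σ.Node} (ht : t ≠ σ.tree.root) (hl : σ.tree.IsLeaf t) :
    Caught (σ.pos (σ.tree.parent t).1) (σ.coneDown t) := by
  by_contra hc
  obtain ⟨e, he⟩ := edgeComps_nonempty (coneDown_mem ht)
  obtain ⟨c, hc, -⟩ := exists_child ht hc he
  exact hl c hc

/-- Each cone meets the cone above it, and an edge component lies within a connected component of
the whole graph; so the descent never leaves the component chosen at the root. -/
theorem coneDown_subset_top {c : σ.Node} (hc : σ.tree.IsChild σ.tree.root c) {t : σ.Node}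
    (h : σ.tree.Below c t) : σ.coneDown t ⊆ σ.coneDown c := by
  induction t using σ.tree.induction with
  | h0 => exact absurd (RTree.below_root h) hc.1
  | h1 t ht ih =>
    rcases RTree.below_iff.1 h with rfl | h
    · exact subset_rfl
    · have hp : σ.tree.parent t ≠ σ.tree.root := fun h' => hc.1 (RTree.below_root (h' ▸ h))
      obtain ⟨e, het, hep⟩ := (child_spec hp ⟨ht, rfl⟩).2
      have hec := ih h hep
      rw [(edgeComps_eq (coneDown_mem ht) het).2,
        (edgeComps_eq (coneDown_mem_of_isChild hc) hec).2]
      exact edgeComp_anti (empty_subset _) e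

theorem treeData_part (t : σ.Node) :
    IsPartitionOf E (cells σ.tree E σ.treeData.down σ.treeData.up t) := by
  constructor
  · ext e
    rw [mem_iUnion]
    constructor
    · rintro ⟨c | _ | _, he⟩
      · exact coneDown_subset c he.2
      · exact he.2.1
      · exact he.2.2.1
    · intro he
      by_cases hc : ∃ c, σ.tree.IsChild t c ∧ e ∈ σ.coneDown c
      · obtain ⟨c, hc⟩ := hc
        exact ⟨.inl c, hc⟩
      · have ht : t ≠ σ.tree.root := by
          rintro rfl
          obtain ⟨c, hc', h⟩ := exists_child_root (σ := σ) he
          exact hc ⟨c, hc', h ▸ mem_edgeComp_self he⟩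
        by_cases hu : e ∈ σ.treeData.up t
        · exact ⟨.inr false, ht, hu⟩
        · refine ⟨.inr true, ht, ?_, he, hu⟩
          by_contra hl
          exact hu ⟨he, fun c h h' => hc ⟨c, h, h'⟩, fun h => absurd h hl⟩
  · rintro (c | _ | _) (d | _ | _) hij <;> rw [disjoint_left] <;> intro e he he'
    · exact hij (congrArg _ (eq_of_mem_coneDown he.1 he'.1 he.2 he'.2))
    · exact he'.2.2.1 c he.1 he.2
    · exact he'.2.1 c he.1
    · exact he.2.2.1 d he'.1 he'.2
    · exact hij rfl
    · exact he'.2.2.2 he.2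
    · exact he.2.1 d he'.1
    · exact he.2.2.2 he'.2
    · exact hij rfl

theorem treeData_disj (t : σ.Node) (ht : t ≠ σ.tree.root) :
    Disjoint (σ.treeData.down t) (σ.treeData.up t) := by
  rw [disjoint_left]
  rintro e (he : e ∈ σ.coneDown t) ⟨-, h1, h2⟩
  by_cases hl : σ.tree.IsLeaf t
  · exact h2 hl he
  · by_cases hc : Caught (σ.pos (σ.tree.parent t).1) (σ.coneDown t)
    · exact hl fun c h => (child_spec ht h).1 hc
    · obtain ⟨c, hc, hec⟩ := exists_child ht hc he
      exact h1 c hc hec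

theorem treeData_leaf (t : σ.Node) (ht : t ≠ σ.tree.root) (hl : σ.tree.IsLeaf t) :
    (E \ σ.treeData.up t).encard ≤ 1 := by
  obtain ⟨f, hf, -⟩ := caught_of_isLeaf ht hl
  refine (encard_le_encard (t := {f}) ?_).trans (encard_singleton f).le
  rintro e ⟨he, he'⟩
  by_contra hef
  exact he' ⟨he, fun c hc => absurd hc (hl c), fun _ => hf ▸ hef⟩

theorem treeData_top_up {c : σ.Node} (hc : σ.tree.IsChild σ.tree.root c) {t : σ.Node}
    (h : σ.tree.Below c t) : E \ σ.treeData.up t ⊆ σ.treeData.down c := by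
  rintro e ⟨he, he'⟩
  by_contra hec
  refine he' ⟨he, fun d hd hed => hec ?_, fun _ het => hec (coneDown_subset_top hc h het)⟩
  exact coneDown_subset_top hc (h.trans (hd.2 ▸ RTree.parent_below d)) hed

/-- Two component cones meeting at a vertex share its loop, hence coincide. -/
theorem treeData_bdry_root (hE : ∀ v, s(v, v) ∈ E) :
    famBdry E (cells σ.tree E σ.treeData.down σ.treeData.up σ.tree.root) = ∅ := by
  ext v
  simp only [mem_empty_iff_false, iff_false]
  intro hv
  obtain ⟨i, j, hij, ⟨e, he, hev⟩, ⟨f, hf, hfv⟩⟩ :=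
    exists_inc_of_mem_famBdry (treeData_part _) hv
  rcases i with c | _ | _
  · rcases j with d | _ | _
    · refine hij (congrArg _ (eq_of_mem_coneDown he.1 hf.1 (e := s(v, v)) ?_ ?_))
      · exact loop_mem_edgeComps (coneDown_mem_of_isChild he.1) ⟨e, he.2, hev⟩
          (notMem_empty v) (hE v)
      · exact loop_mem_edgeComps (coneDown_mem_of_isChild hf.1) ⟨f, hf.2, hfv⟩
          (notMem_empty v) (hE v)
    · exact hf.1 rfl
    · exact hf.1 rfl
  · exact he.1 rfl
  · exact he.1 rfl

/-! ### The strategy tree is finite -/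

theorem coneDown_inter_nonempty {t c : σ.Node} (h : σ.tree.IsChild t c)
    (ht : t ≠ σ.tree.root) : (σ.coneDown c ∩ σ.coneDown t).Nonempty := (child_spec ht h).2

/-- The robber follows the branch, staying in round `i` on an edge common to two consecutive cones.
Being caught would make the current cone a single occupied edge, and the branch would end. -/
theorem not_infinite_branch {q : ℕ} (hσ : σ.IsWinning q) (t : ℕ → σ.Node)
    (h0 : t 0 = σ.tree.root) (ht : ∀ i, σ.tree.IsChild (t i) (t (i + 1))) : False := by
  have hmem : ∀ i, ∃ e, e ∈ σ.coneDown (t (i + 1)) ∧ (i ≠ 0 → e ∈ σ.coneDown (t i)) := by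
    intro i
    by_cases hi : i = 0
    · obtain ⟨e, he⟩ := edgeComps_nonempty (coneDown_mem_of_isChild (ht i))
      exact ⟨e, he, fun h => absurd hi h⟩
    · obtain ⟨j, rfl⟩ := Nat.exists_eq_succ_of_ne_zero hi
      obtain ⟨e, he, he'⟩ := coneDown_inter_nonempty (ht (j + 1)) (ht j).1
      exact ⟨e, he, fun _ => he'⟩
  choose e he he' using hmem
  have hpar : ∀ i, σ.tree.parent (t (i + 1)) = t i := fun i => (ht i).2
  have hnc : ∀ i, ¬ Caught (σ.pos (t i).1) (σ.coneDown (t (i + 1))) := by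
    intro i
    have := (child_spec (ht i).1 (ht (i + 1))).1
    rwa [hpar] at this
  have hR : ∀ i, σ.coneDown (t (i + 1)) ∈ edgeComps E (σ.pos (t i).1) :=
    fun i => coneDown_mem_of_isChild (ht i)
  have hplay : σ.IsPlay (fun i => σ.pos (t i).1) e := by
    refine ⟨?_, coneDown_subset _ (he 0), fun i => ?_, fun i => ?_⟩
    · simp only [h0]; rfl
    · obtain ⟨R, l, h1, h2, h3⟩ := exists_cons (ht i).1
      rw [hpar] at h2
      have hnc := hnc i
      have hR := hR i
      have hei := he i
      rw [h3] at hnc hR hei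
      simp only [h1]
      subst h2
      rw [pos_cons hnc, moveOn_eq (encard_pos_le (t i).2) hR hei]
    -- The robber even stays in his component with respect to the old cop position, which is
    -- contained in the one that the rules allow.
    · refine edgeComp_anti inter_subset_left _ ?_
      rw [← (edgeComps_eq (hR i) (he i)).2]
      exact he' (i + 1) i.succ_ne_zero
  obtain ⟨i, hi, -⟩ := hσ _ _ hplay
  refine hnc i ⟨e i, ?_, hi⟩
  obtain ⟨heE, h⟩ := edgeComps_eq (hR i) (he i)
  rw [h]
  exact edgeComp_eq_singleton heE hi

theorem finite_children [Finite V] (t : σ.Node) : {c | σ.tree.IsChild t c}.Finite :=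
  Set.Finite.of_injOn (f := σ.coneDown) (t := univ) (fun _ _ => mem_univ _)
    (fun _ hc _ hd h => eq_of_coneDown_eq hc hd h) finite_univ

/-- Kőnig's lemma: always move on to a child with infinitely many nodes above it. -/
theorem finite_node [Finite V] {q : ℕ} (hσ : σ.IsWinning q) : Finite σ.Node := by
  by_contra hinf
  have hstep : ∀ t : σ.Node, ({u | σ.tree.Below t u}).Infinite →
      ∃ c, σ.tree.IsChild t c ∧ ({u | σ.tree.Below c u}).Infinite := by
    intro t ht
    by_contra! hfin
    refine ht (((finite_singleton t).union ((finite_children t).biUnion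
      fun c hc => hfin c hc)).subset fun u hu => ?_)
    by_cases h : u = t
    · exact .inl h
    · obtain ⟨c, hc, hcu⟩ := RTree.exists_child_below hu (Ne.symm h)
      exact .inr (mem_biUnion hc hcu)
  choose! next hnext hnext' using hstep
  have hroot : ({u | σ.tree.Below σ.tree.root u}).Infinite := by
    intro h
    refine hinf (finite_univ_iff.1 (h.subset fun u _ => RTree.root_below u))
  have hall : ∀ i, ({u | σ.tree.Below (next^[i] σ.tree.root) u}).Infinite := by
    intro i
    induction i with
    | zero => exact hroot
    | succ i ih => rw [Function.iterate_succ_apply']; exact hnext' _ ih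
  refine not_infinite_branch hσ (fun i => next^[i] σ.tree.root) rfl fun i => ?_
  rw [Function.iterate_succ_apply']
  exact hnext _ (hall i)

end CopStrategy

/-! ### The strategy tree as starting point of the construction. -/

namespace CopStrategy

variable {V : Type*} {E : Set (Sym2 V)} {k : ℕ} {σ : CopStrategy E k}

theorem treeData_steady (hE : ∀ v, s(v, v) ∈ E) : Steady σ.tree σ.treeData where
  separated := by
    intro t c d v ht hc hd hcd hvc hvd hvu
    -- If `v` were unoccupied, both child cones would contain its loop.
    have hvt : v ∈ σ.pos t.1 := by
      by_contra hv
      exact hcd (eq_of_mem_coneDown hc hd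
        (loop_mem_edgeComps (coneDown_mem_of_isChild hc) hvc hv (hE v))
        (loop_mem_edgeComps (coneDown_mem_of_isChild hd) hvd hv (hE v)))
    -- Otherwise the loop lies in the cone to the parent, against `hvu`: since `v` is occupied, a
    -- child cone containing the loop consists of it alone, and child cones meet the cone of `t`.
    have hloop : s(v, v) ∈ σ.coneDown t := by
      by_contra hl
      refine hvu ⟨s(v, v), ⟨hE v, fun a ha hva => hl ?_, fun _ => hl⟩, Sym2.mem_mk_left v v⟩
      have hR := eq_singleton_of_loop_mem (coneDown_mem_of_isChild ha) hvt hva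
      obtain ⟨e, he, het⟩ := (child_spec ht ha).2
      rw [hR] at he
      exact he ▸ het
    -- Were `v` occupied at the parent already, the cone of `t` would be the loop alone and the
    -- robber caught, yet `t` has children.
    refine ⟨hvt, fun hvp => (child_spec ht hc).1 ?_, s(v, v), hloop, Sym2.mem_mk_left v v⟩
    refine ⟨s(v, v), eq_singleton_of_loop_mem (coneDown_mem ht) hvp hloop, fun w hw => ?_⟩
    rw [Sym2.mem_iff, or_self] at hw
    rwa [hw]
  new_le_one := by
    intro t ht
    obtain ⟨R, l, h1, h2, -⟩ := exists_cons ht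
    have := t.2
    rw [h1] at this
    change (σ.pos t.1 \ σ.pos (σ.tree.parent t).1).encard ≤ 1
    rw [h1, h2]
    exact encard_pos_diff_le this

theorem treeData_runInv (hE : ∀ v, s(v, v) ∈ E) :
    RunInv σ.tree E σ.treeData ∅ σ.treeData where
  part := treeData_part
  disj := treeData_disj
  edge _ _ h := absurd h (notMem_empty _)
  up_eq _ _ := rfl
  down_eq _ _ := rfl
  bag_eq _ h := absurd h (notMem_empty _)
  bag_root := rfl
  bdry_root := treeData_bdry_root hE
  leaf := treeData_leaf
  top_down _ _ := rfl
  top_up _ hc _ h := treeData_top_up hc h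
  depth_le _ h := absurd h (notMem_empty _)

theorem exists_child_root_component (hE : ∀ v, s(v, v) ∈ E)
    (C : (deleteVerts E ∅).ConnectedComponent) :
    ∃ c : σ.Node, σ.tree.IsChild σ.tree.root c ∧
      σ.coneDown c = {e | e ∈ E ∧ ∃ u ∈ e, u ∈ C.supp} := by
  induction C using SimpleGraph.ConnectedComponent.ind with
  | h u =>
    obtain ⟨c, hc, h⟩ := exists_child_root (σ := σ) (hE u)
    refine ⟨c, hc, ?_⟩
    rw [h]
    ext e
    refine and_congr_right fun he => ?_
    constructor
    · rintro (rfl | ⟨a, ha, b, hb, -, -, hr⟩)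
      · exact ⟨u, Sym2.mem_mk_left u u, rfl⟩
      · rw [Sym2.mem_iff, or_self] at ha
        subst ha
        exact ⟨b, hb, SimpleGraph.ConnectedComponent.eq.2 hr.symm⟩
    · rintro ⟨b, hb, hbu⟩
      exact .inr ⟨u, Sym2.mem_mk_left u u, b, hb, notMem_empty _, notMem_empty _,
        (SimpleGraph.ConnectedComponent.eq.1 hbu).symm⟩

end CopStrategy

/-! ### Runs of the construction -/

section Run

variable {N V : Type*} {T : RTree N} {E : Set (Sym2 V)} {n : ℕ} {s : Fin n ≃ N}

/-- The nodes considered before step `i`. -/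
def processed (s : Fin n ≃ N) (i : ℕ) : Set N := {t | (s.symm t : ℕ) < i}

theorem processed_succ (s : Fin n ≃ N) (i : Fin n) :
    processed s (i + 1) = insert (s i) (processed s i) := by
  ext t
  rw [mem_insert_iff, ← Equiv.symm_apply_eq, Fin.ext_iff]
  simp only [processed]
  exact Nat.lt_succ_iff_lt_or_eq.trans or_comm

theorem parent_le_of_bfs (hb : ∀ a b, a ≤ b → T.level (s a) ≤ T.level (s b)) {t : N}
    (ht : t ≠ T.root) : s.symm (T.parent t) < s.symm t := by
  by_contra! h
  have := hb _ _ h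
  rw [Equiv.apply_symm_apply, Equiv.apply_symm_apply, RTree.level_of_ne ht] at this
  omega

/-- Levels increase from parent to child, so in a level-by-level order each parent is considered
before its children. -/
theorem frontier_of_bfs (hb : ∀ a b, a ≤ b → T.level (s a) ≤ T.level (s b)) (i : Fin n) :
    Frontier T (processed s i) (s i) where
  notMem h := by simp [processed] at h
  closed t h := by
    by_cases ht : t = T.root
    · rw [ht, T.parent_root, ← ht]; exact h
    · exact lt_trans (Fin.lt_def.1 (parent_le_of_bfs hb ht)) h
  parent_mem := by
    by_cases ht : s i = T.root
    · exact .inl ht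
    · have := parent_le_of_bfs hb ht
      rw [Equiv.symm_apply_apply] at this
      exact .inr this

theorem subtreeNodes_eq_hull (hb : ∀ a b, a ≤ b → T.level (s a) ≤ T.level (s b)) (i : Fin n) :
    subtreeNodes T s i = hull T (insert (s i) (processed s i)) := by
  have fr := frontier_of_bfs hb i
  have hmem : ∀ a, a ≤ i → s a ∈ insert (s i) (processed s i) := by
    intro a ha
    rw [← processed_succ]
    simpa [processed, Nat.lt_succ_iff] using ha
  have hpar : ∀ t, t ∈ insert (s i) (processed s i) →
      T.parent t ∈ insert (s i) (processed s i) :=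
    fun t ht => fr.mem_insert_of_below (RTree.parent_below t) ht
  ext t
  constructor
  · rintro ⟨a, ha, rfl | h | h⟩
    · exact hpar _ (hmem a ha)
    · change T.parent t ∈ insert (s i) (processed s i)
      rw [h.2]
      exact hmem a ha
    · change T.parent t ∈ insert (s i) (processed s i)
      rw [← h.2]
      exact hpar _ (hpar _ (hmem a ha))
  · intro h
    change T.parent t ∈ insert (s i) (processed s i) at h
    have ha : s.symm (T.parent t) ≤ i := by
      rw [← processed_succ] at h
      exact Nat.lt_succ_iff.1 h
    refine ⟨_, ha, ?_⟩
    rw [Equiv.apply_symm_apply]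
    by_cases ht : t = T.root
    · rw [ht, T.parent_root]; exact .inl rfl
    · exact .inr (.inl ⟨ht, rfl⟩)

theorem IsRun.runInv [Finite V] {D₀ : TreeData N V} {D : ℕ → TreeData N V}
    (hrun : IsRun T E D₀ s D) (hs : Steady T D₀) (h₀ : RunInv T E D₀ ∅ D₀) :
    RunInv T E D₀ univ (D n) := by
  have key : ∀ i ≤ n, RunInv T E D₀ (processed s i) (D i) := by
    intro i hi
    induction i with
    | zero =>
      have : processed s 0 = ∅ := by simp [processed]
      rw [hrun.start, this]
      exact h₀
    | succ i ih =>
      have hI := ih (Nat.le_of_succ_le hi)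
      have hsucc := processed_succ s ⟨i, hi⟩
      simp only at hsucc
      rw [hsucc]
      rcases hrun.step ⟨i, hi⟩ with ⟨hl, hD⟩ | ⟨hl, F, hF, hD⟩
      · simp only at hD
        rw [hD]
        exact hI.insert_leaf hl
      · rw [subtreeNodes_eq_hull hrun.bfs] at hD
        simp only at hD hF
        rw [hD]
        exact hI.insert_newData hs (frontier_of_bfs hrun.bfs ⟨i, hi⟩) hl hF
  have huniv : processed s n = univ := eq_univ_of_forall fun t => (s.symm t).isLt
  exact huniv ▸ key n le_rfl

/-- A lexicographic minimum over the finitely many admissible choices, which include the empty one.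
-/
theorem exists_optimal [Finite N] [Finite V] (T : RTree N) (E : Set (Sym2 V))
    (D : TreeData N V) (x : N) : ∃ F, Optimal T E D x F := by
  have h0 : Admissible T E D x fun _ => ∅ :=
    ⟨fun _ _ => empty_subset _, fun _ _ => rfl, fun _ _ _ => disjoint_bot_left⟩
  obtain ⟨F₁, h₁, hmin₁⟩ := exists_min_image {F | Admissible T E D x F}
    (fun F => (famBdry E (extCells T E D x F)).encard) (toFinite _) ⟨_, h0⟩
  obtain ⟨F₂, h₂, hmin₂⟩ := exists_min_image {F | Admissible T E D x F ∧
      (famBdry E (extCells T E D x F)).encard = (famBdry E (extCells T E D x F₁)).encard}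
    (fun F => (⋃ c, F c).encard) (toFinite _) ⟨F₁, h₁, rfl⟩
  exact ⟨F₂, h₂.1, fun F hF => h₂.2.trans_le (hmin₁ F hF),
    fun F hF h => hmin₂ F ⟨hF, h.trans h₂.2⟩⟩

theorem exists_isRun [Finite N] [Finite V] (T : RTree N) (E : Set (Sym2 V))
    (D₀ : TreeData N V) : ∃ (n : ℕ) (s : Fin n ≃ N) (D : ℕ → TreeData N V),
      IsRun T E D₀ s D := by
  classical
  obtain ⟨n, ⟨e⟩⟩ := Finite.exists_equiv_fin N
  let f : Fin n → ℕ := fun i => T.level (e.symm i)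
  let s : Fin n ≃ N := (Tuple.sort f).trans e.symm
  have hstep : ∀ (i : Fin n) (D : TreeData N V), ∃ D', IsStep T E s i D D' := by
    intro i D
    by_cases hl : T.IsLeaf (s i)
    · exact ⟨D, .inl ⟨hl, rfl⟩⟩
    · obtain ⟨F, hF⟩ := exists_optimal T E D (s i)
      exact ⟨_, .inr ⟨hl, F, hF, rfl⟩⟩
  choose next hnext using hstep
  -- After the last node the sequence is continued as a constant.
  let D : ℕ → TreeData N V := fun i =>
    Nat.rec D₀ (fun j D => if h : j < n then next ⟨j, h⟩ D else D) i
  refine ⟨n, s, D, fun a b hab => Tuple.monotone_sort f hab, rfl, fun i => ?_⟩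
  have : D (i + 1) = next i (D i) := dif_pos i.isLt
  rw [this]
  exact hnext i (D i)

end Run

/-! ### The theorem, read off from the invariant with all nodes considered. -/

theorem mainTheorem4 {V : Type*} [Finite V] (G : Set (Sym2 V)) (k q : ℕ) (hk : 1 ≤ k) (hq : 1 ≤ q)
    (σ : CopStrategy (withLoops G) k) (hσ : σ.IsWinning q) :
    Finite σ.Node ∧
    (∃ (n : ℕ) (s : Fin n ≃ σ.Node) (D : ℕ → TreeData σ.Node V),
      IsRun σ.tree (withLoops G) σ.treeData s D) ∧
    ∀ (n : ℕ) (s : Fin n ≃ σ.Node) (D : ℕ → TreeData σ.Node V),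
      IsRun σ.tree (withLoops G) σ.treeData s D →
      (D n).IsPreTree σ.tree (withLoops G) ∧
      (D n).IsExact σ.tree (withLoops G) ∧
      (D n).depth σ.tree ≤
        ⨆ ℓ : {ℓ : σ.Node // σ.tree.IsLeaf ℓ},
          {t | σ.tree.Below t ℓ ∧ σ.treeData.IsBranching σ.tree t}.encard := by
  have hfin : Finite σ.Node := CopStrategy.finite_node hσ
  have hE : ∀ v : V, s(v, v) ∈ withLoops G := fun v => .inr ⟨v, rfl⟩
  refine ⟨hfin, exists_isRun _ _ _, fun n s D hrun => ?_⟩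
  have hI := hrun.runInv (CopStrategy.treeData_steady hE) (CopStrategy.treeData_runInv hE)
  have hedge := fun t ht => hI.edge t ht (mem_univ _)
  have hbag := fun t => hI.bag_eq t (mem_univ _)
  refine ⟨⟨hI.bag_root, fun C => ?_, fun t ht hl => ?_, hI.part, fun t => (hbag t).ge, hI.disj⟩,
    ⟨hedge, hbag⟩, iSup_le fun t => ?_⟩
  · obtain ⟨c, hc, h⟩ := CopStrategy.exists_child_root_component (σ := σ) hE C
    exact ⟨c, hc, (hI.top_down c hc).trans h⟩
  · refine (encard_le_encard fun e he =>
      mem_sdiff_of_mem (hI.down_subset ht he) fun hu => ?_).trans (hI.leaf t ht hl)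
    exact disjoint_left.1 (hI.disj t ht) he hu
  -- The depth is a supremum over all nodes; counting branching nodes is monotone along paths, so
  -- each node is covered by a leaf above it.
  · obtain ⟨ℓ, hℓ, htl⟩ := RTree.exists_leaf_above (T := σ.tree) t
    refine (hI.depth_le t (mem_univ _)).trans ((branchCount_mono htl).trans ?_)
    exact le_iSup (fun ℓ : {ℓ : σ.Node // σ.tree.IsLeaf ℓ} =>
      {t | σ.tree.Below t ℓ ∧ σ.treeData.IsBranching σ.tree t}.encard) ⟨ℓ, hℓ⟩
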